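/- **Setting.** Let $d\ge 1$. Let $X_1,X_2,\dots$ be i.i.d. in $[0,1]^d$ with a Lebesgue density bounded between two constants $0<c_1\le c_2$ on $[0,1]^d$. Let $f$ be bounded and Lipschitz on $[0,1]^d$. Let $\epsilon_1,\epsilon_2,\dots$ be i.i.d. sub-Gaussian errors, independent of $(X_i)$, with $\mathbb E[\epsilon_i]=0$, $\mathbb E[\epsilon_i^2]=\sigma_\epsilon^2$ and $\mathbb E[\epsilon_i^4]<\infty$. Put $Y_i=f(X_i)+\epsilon_i$. **Trees.** A tree structure $q$ is a finite partition of $[0,1]^d$ into nonempty hyper-rectangles, called leaves. For each $n$ let $Q_n$ be a finite set of tree structures. Given a sample $(x_i,y_i)_{i\le n}$, let $\mathcal Q_n$ be a probability measure on $Q_n$ that may depend (measurably) on the covariates $x_1,\dots,x_n$, but neither on the responses (structure-value isolation) nor on the boosting iteration (non-adaptivity). Draw $q\sim\mathcal Q_n$ and, independently, a uniformly random subset $w\subseteq\{1,\dots,n\}$ of size $m_n\le n$, where $m_n\ge n^{\frac{d+1}{d+2}}\log n$ for all large $n$. The structure vector $s_n(z)\in\mathbb R^n$ at a point $z$ in the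 leaf $A\in q$ has entries $$s_{n,k}(z)=\frac{I(x_k\in A)\,I(k\in w)}{\sum_{i}I(x_i\in A)\,I(i\in w)},\qquad 0/0:=0,$$ and is $0$ if $z$ lies in no leaf. The structure matrix $S_n$ has rows $s_n(x_1)^T,\dots,s_n(x_n)^T$. Let $0<\lambda<1$ and, with expectations over $(q,w)$, put $$k_n^T=\mathbb E[s_n(x)]^T,\quad K_n=\mathbb E[S_n],\quad r_n^T=k_n^T\left[\tfrac1\lambda I+K_n\right]^{-1}.$$ **Boulevard.** Given the sample, let $s_{b}$, $b\ge1$, be the structure vectors of independent copies of $(q,w)$. Put $\hat f_{0,n}=0$ and $$\hat f_{b,n}(z)=\tfrac{b-1}{b}\hat f_{b-1,n}(z)+\tfrac{\lambda}{b}\sum_{k=1}^n s_{b,k}(z)\bigl(y_k-\Gamma(\hat f_{b-1,n}(x_k))\bigr),$$ where $\Gamma$ is either the identity or the truncation $\Gamma_M(u)=\operatorname{sign}(u)\min(|u|,M)$ at a level $M$ that is large enough given the sample. The Boulevard prediction $\hat f_n(x)$ is the limit of $\hat f_{b,n}(x)$ as $b\to\infty$. **Lemma.** Let $x\in[0,1]^d$.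 Suppose that, for some $\varepsilon_1>0$, $\nu>0$, $\alpha>0$ and some sequence $d_n>0$, $$\sup_{A\in q\in Q_n}\operatorname{diam}(A)=O(d_n),\qquad d_n=O\!\left(n^{-\frac1{d+2}-\varepsilon_1}\right),$$ that the leaf volumes satisfy, for some $c>0$ and all large $n$, $$\inf_{A\in q\in Q_n}\operatorname{Vol}(A)\ge c\,v_n,\qquad v_n=n^{-\frac{d+1}{d+2}+\nu},$$ and that $$|Q_n|=O\!\left(\frac1n\exp\!\left(\tfrac12 n^{\frac1{d+2}-\nu}-n^{\alpha}\right)\right).$$ Then, for every $n$ and every sample of size $n$, $\hat f_{b,n}(x)$ converges, almost surely with respect to the random trees and subsamples, to a limit $\hat f_n(x)$ that depends only on the sample (the same limit for $\Gamma=\mathrm{id}$ and for $\Gamma=\Gamma_M$ with $M$ large). For the random sample $(X_1,Y_1),\dots,(X_n,Y_n)$, with $f(X_n):=(f(X_1),\dots,f(X_n))^T$, $$\frac{\hat f_n(x)-r_n^T f(X_n)}{\|r_n\|}\;\xrightarrow{d}\;N(0,\sigma_\epsilon^2)\qquad(n\to\infty)$$ unconditionally, that is, under the joint law of the covariates and the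 errors. Here $\|\cdot\|$ is the Euclidean norm, and the quotient is read as $0$ where $r_n=0$. -/

import Mathlib

open MeasureTheory ProbabilityTheory Filter Topology
open scoped NNReal ENNReal Matrix

/-- The covariate space `[0,1]^d`, inside Euclidean `d`-space. -/
def unitCube (d : ℕ) : Set (EuclideanSpace ℝ (Fin d)) :=
  {z | ∀ j, z j ∈ Set.Icc (0 : ℝ) 1}

/-- A hyper-rectangle: a product of `d` intervals, each of which may be open, closed or half-open. -/
def IsHyperrectangle {d : ℕ} (A : Set (EuclideanSpace ℝ (Fin d))) : Prop :=
  ∃ I : Fin d → Set ℝ, (∀ j, (I j).OrdConnected) ∧ A = {z | ∀ j, z j ∈ I j}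

/-- The structure of a regression tree: a finite partition of `[0,1]^d` into nonempty
hyper-rectangles, the leaves. -/
@[ext]
structure TreeStructure (d : ℕ) where
  leaves : Finset (Set (EuclideanSpace ℝ (Fin d)))
  rectangle : ∀ A ∈ leaves, IsHyperrectangle A
  nonempty : ∀ A ∈ leaves, A.Nonempty
  disjoint : ∀ A ∈ leaves, ∀ B ∈ leaves, A ≠ B → Disjoint A B
  cover : (⋃ A ∈ leaves, A) = unitCube d

/-- What is drawn at random in one boosting iteration on a sample of size `n`: a tree structure and
the set of indices of the subsample that decides the leaf values. -/
structure TreeDraw (d n : ℕ) where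
  tree : TreeStructure d
  subsample : Finset (Fin n)

/-- All draw laws below are discrete, so every set of draws is measurable. -/
instance (d n : ℕ) : MeasurableSpace (TreeDraw d n) := ⊤

noncomputable section

open scoped Classical in
/-- The structure vector `s_n(z)` of a draw with leaves `q` and subsample `w`: if `z` lies in the
leaf `A` then its `k`-th entry is `I(x_k ∈ A) I(k ∈ w) / ∑_i I(x_i ∈ A) I(i ∈ w)`, with `0/0 = 0`.
(The sum over the leaves has at most one nonzero term.) -/
def structureVector {d n : ℕ} (D : TreeDraw d n) (xs : Fin n → EuclideanSpace ℝ (Fin d))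
    (z : EuclideanSpace ℝ (Fin d)) (k : Fin n) : ℝ :=
  ∑ A ∈ D.tree.leaves,
    if z ∈ A then
      (if xs k ∈ A ∧ k ∈ D.subsample then (1 : ℝ) else 0) /
        ∑ i, if xs i ∈ A ∧ i ∈ D.subsample then (1 : ℝ) else 0
    else 0

/-- A non-adaptive tree building scheme with structure-value isolation. For each sample size `n`
there are a finite tree space `Q n`, and, given the covariates `xs`, a probability distribution
`law n xs` on it. This law depends neither on the boosting iteration (non-adaptivity) nor on the
responses (structure-value isolation). The subsamples have size `m n`. -/
structure TreeScheme (d : ℕ) where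
  Q : ℕ → Finset (TreeStructure d)
  law : (n : ℕ) → (Fin n → EuclideanSpace ℝ (Fin d)) → PMF (TreeStructure d)
  support_law : ∀ n xs, (law n xs).support ⊆ (Q n : Set (TreeStructure d))
  measurable_law : ∀ n q, Measurable fun xs => law n xs q
  m : ℕ → ℕ
  m_le : ∀ n, m n ≤ n

/-- The uniform distribution on the subsets of `{1, …, n}` of size `m`. -/
def uniformSubsample (n m : ℕ) (h : m ≤ n) : PMF (Finset (Fin n)) :=
  PMF.uniformOfFinset (Finset.powersetCard m Finset.univ)
    (Finset.powersetCard_nonempty.mpr (by simpa using h))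

namespace TreeScheme

variable {d : ℕ} (S : TreeScheme d)

/-- The law of one draw given the covariates: the tree structure has law `S.law n xs` and the
subsample is independent of it and uniform among the index sets of size `S.m n`. -/
def drawLaw (n : ℕ) (xs : Fin n → EuclideanSpace ℝ (Fin d)) : PMF (TreeDraw d n) :=
  (S.law n xs).bind fun q =>
    (uniformSubsample n (S.m n) (S.m_le n)).map fun w => ⟨q, w⟩

/-- The joint law, given the sample, of the draws used in all boosting iterations: they are
independent and identically distributed. -/
def drawSeqLaw (n : ℕ) (xs : Fin n → EuclideanSpace ℝ (Fin d)) : Measure (ℕ → TreeDraw d n) :=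
  Measure.infinitePi fun _ => (S.drawLaw n xs).toMeasure

/-- `k_n = 𝔼[s_n(z)]`, the expectation being over tree structure and subsample. -/
def kVec (n : ℕ) (xs : Fin n → EuclideanSpace ℝ (Fin d)) (z : EuclideanSpace ℝ (Fin d)) :
    Fin n → ℝ :=
  fun i => ∫ D, structureVector D xs z i ∂(S.drawLaw n xs).toMeasure

/-- `K_n = 𝔼[S_n]`, where the rows of `S_n` are the structure vectors of the sample points. -/
def kMat (n : ℕ) (xs : Fin n → EuclideanSpace ℝ (Fin d)) : Matrix (Fin n) (Fin n) ℝ :=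
  Matrix.of fun i j => ∫ D, structureVector D xs (xs i) j ∂(S.drawLaw n xs).toMeasure

/-- `r_nᵀ = k_nᵀ (λ⁻¹ I + K_n)⁻¹`. -/
def rVec (lam : ℝ) (n : ℕ) (xs : Fin n → EuclideanSpace ℝ (Fin d))
    (z : EuclideanSpace ℝ (Fin d)) : Fin n → ℝ :=
  S.kVec n xs z ᵥ* ((1 / lam) • (1 : Matrix (Fin n) (Fin n) ℝ) + S.kMat n xs)⁻¹

end TreeScheme

/-- The truncation `Γ_M(u) = sign(u) (|u| ∧ M)`. -/
def truncation (M u : ℝ) : ℝ := Real.sign u * min |u| M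

/-- The Boulevard iteration on the sample `(xs, ys)` with learning rate `lam`, along a sequence of
draws: `f̂_0 = 0` and
`f̂_b(z) = ((b-1)/b) f̂_{b-1}(z) + (lam/b) ∑_k s_{b,k}(z) (y_k - Γ(f̂_{b-1}(x_k)))` for `b ≥ 1`.
Here `Γ = id` gives the plain algorithm. -/
def boulevard {d n : ℕ} (lam : ℝ) (Γ : ℝ → ℝ) (xs : Fin n → EuclideanSpace ℝ (Fin d))
    (ys : Fin n → ℝ) (D : ℕ → TreeDraw d n) : ℕ → EuclideanSpace ℝ (Fin d) → ℝ
  | 0 => fun _ => 0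
  | b + 1 => fun z =>
      ((b : ℝ) / ((b : ℝ) + 1)) * boulevard lam Γ xs ys D b z +
        (lam / ((b : ℝ) + 1)) *
          ∑ k, structureVector (D b) xs z k * (ys k - Γ (boulevard lam Γ xs ys D b (xs k)))

/-- `c` is the Boulevard prediction at `z` for the sample `(xs, ys)`: almost surely with respect to
the random trees and subsamples, the number of boosting iterations tending to infinity, the
Boulevard iterates at `z` converge to `c`, both for the plain algorithm and for the algorithm with
truncation at any large enough level `M`. -/
def IsBoulevardLimit {d : ℕ} (S : TreeScheme d) (lam : ℝ) (n : ℕ)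
    (xs : Fin n → EuclideanSpace ℝ (Fin d)) (ys : Fin n → ℝ) (z : EuclideanSpace ℝ (Fin d))
    (c : ℝ) : Prop :=
  (∀ᵐ D ∂(S.drawSeqLaw n xs),
      Tendsto (fun b => boulevard lam id xs ys D b z) atTop (𝓝 c)) ∧
    ∀ᶠ M : ℝ in atTop, ∀ᵐ D ∂(S.drawSeqLaw n xs),
      Tendsto (fun b => boulevard lam (truncation M) xs ys D b z) atTop (𝓝 c)

end

/-! ### Structure vectors of a single draw. -/

section StructureVector

variable {d n : ℕ}

/-! For a fixed sample the Boulevard limit can be computed exactly: it is `r_nᵀ Y`. The running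
means of the structure vectors converge almost surely to `k_n` and to the rows of `K_n` by the
strong law. Along such a sequence of draws, the distance of the iterates to the solution of the
limiting fixed-point equation is at most `λ < 1` times its own running mean plus a vanishing error,
so it vanishes (`tendsto_boulevard_of_tendsto_average`, `isBoulevardLimit_rVec`). The iterates are
bounded, so a high truncation level never acts.

Since `Y = f(X) + ε`, the quotient is a sum `∑ a_i ε_i` with weights `a = r_n / ‖r_n‖` that depend
on the covariates only, hence are independent of the errors. Conditionally on the covariates, a
characteristic function computation gives the Gaussian limit as soon as the weights have norm one
and are uniformly small with probability tending to one (`tendstoInDistribution_weighted_sum`).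

It remains to bound `max |r_i| / ‖r_n‖`. Relabelling points inside a leaf shows that `K_n` is
symmetric, so its row and column sums are both at most one. The equation for `r_n` then gives `max
|r_i| ≤ C max k_i` and `‖k_n‖ ≤ C ‖r_n‖`. If every leaf at `x` holds at least `N₀` points, then `k_i
≤ 1/N₀`. If moreover the subsample meets these leaves with probability at least 1/2 and the leaves
lie in a ball with at most `M₀` points, Cauchy–Schwarz gives `‖k_n‖² ≥ 1/(4 M₀)`. The squared ratio
is thus of order `M₀ / N₀²` (`TreeScheme.sq_rVec_le`).

With `s = 1/(d+2)`, the volume bound, a Chernoff estimate and a union bound over `Q_n` allow `N₀` of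
order `n^(s+ν)`. The diameter bound and Markov's inequality allow `M₀ = n^(2s)`. The ratio is of
order `n^(-2ν)`, which tends to zero. -/

/-- A point in the leaf `A` lies in no other leaf, so that only `A` contributes. -/
theorem structureVector_of_mem {D : TreeDraw d n} {xs : Fin n → EuclideanSpace ℝ (Fin d)}
    {z : EuclideanSpace ℝ (Fin d)} {A : Set (EuclideanSpace ℝ (Fin d))}
    (hA : A ∈ D.tree.leaves) (hz : z ∈ A) (k : Fin n) :
    structureVector D xs z k =
      A.indicator 1 (xs k) * (if k ∈ D.subsample then 1 else 0) /
        ∑ i ∈ D.subsample, A.indicator (1 : EuclideanSpace ℝ (Fin d) → ℝ) (xs i) := by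
  classical
  unfold structureVector
  rw [Finset.sum_eq_single_of_mem A hA]
  · rw [if_pos hz]
    congr 1
    · by_cases h1 : xs k ∈ A <;> by_cases h2 : k ∈ D.subsample <;> simp [h1, h2]
    · rw [← Finset.sum_filter_add_sum_filter_not Finset.univ (fun i => i ∈ D.subsample)]
      rw [Finset.sum_eq_zero (s := Finset.univ.filter fun i => i ∉ D.subsample)]
      · rw [add_zero, Finset.filter_univ_mem]
        refine Finset.sum_congr rfl fun i hi => ?_
        by_cases h1 : xs i ∈ A <;> simp [h1, hi]
      · intro i hi
        simp only [Finset.mem_filter, Finset.mem_univ, true_and] at hi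
        simp [hi]
  · intro B hB hBA
    rw [if_neg]
    exact fun hzB => (Set.disjoint_left.mp (D.tree.disjoint A hA B hB hBA.symm) hz) hzB

theorem structureVector_of_not_mem {D : TreeDraw d n} {xs : Fin n → EuclideanSpace ℝ (Fin d)}
    {z : EuclideanSpace ℝ (Fin d)} (hz : ∀ A ∈ D.tree.leaves, z ∉ A) (k : Fin n) :
    structureVector D xs z k = 0 := by
  classical
  unfold structureVector
  exact Finset.sum_eq_zero fun A hA => if_neg (hz A hA)

theorem structureVector_nonneg (D : TreeDraw d n) (xs : Fin n → EuclideanSpace ℝ (Fin d))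
    (z : EuclideanSpace ℝ (Fin d)) (k : Fin n) : 0 ≤ structureVector D xs z k := by
  classical
  unfold structureVector
  refine Finset.sum_nonneg fun A _ => ?_
  split_ifs <;> positivity

/-- The entries of a structure vector sum to one if the leaf of `z` meets the subsample, and to
zero otherwise. -/
theorem sum_structureVector_of_mem {D : TreeDraw d n} {xs : Fin n → EuclideanSpace ℝ (Fin d)}
    {z : EuclideanSpace ℝ (Fin d)} {A : Set (EuclideanSpace ℝ (Fin d))}
    (hA : A ∈ D.tree.leaves) (hz : z ∈ A) [Decidable (∃ i ∈ D.subsample, xs i ∈ A)] :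
    ∑ k, structureVector D xs z k = if ∃ i ∈ D.subsample, xs i ∈ A then 1 else 0 := by
  simp_rw [structureVector_of_mem hA hz]
  rw [← Finset.sum_div]
  have h1 : ∑ k, A.indicator (1 : EuclideanSpace ℝ (Fin d) → ℝ) (xs k) * (if k ∈ D.subsample then (1 : ℝ) else 0) =
      ∑ i ∈ D.subsample, A.indicator (1 : EuclideanSpace ℝ (Fin d) → ℝ) (xs i) := by
    simp [Finset.sum_ite_mem]
  rw [h1]
  have hnn : ∀ i ∈ D.subsample, 0 ≤ A.indicator (1 : EuclideanSpace ℝ (Fin d) → ℝ) (xs i) :=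
    fun i _ => Set.indicator_nonneg (fun _ _ => zero_le_one) _
  split_ifs with h
  · obtain ⟨i, hi, hiA⟩ := h
    refine div_self (ne_of_gt (Finset.sum_pos' hnn ⟨i, hi, ?_⟩))
    simp [hiA]
  · push Not at h
    rw [Finset.sum_eq_zero fun i hi => by simp [h i hi], div_zero]

theorem sum_structureVector_le_one (D : TreeDraw d n) (xs : Fin n → EuclideanSpace ℝ (Fin d))
    (z : EuclideanSpace ℝ (Fin d)) : ∑ k, structureVector D xs z k ≤ 1 := by
  classical
  by_cases h : ∃ A ∈ D.tree.leaves, z ∈ A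
  · obtain ⟨A, hA, hz⟩ := h
    rw [sum_structureVector_of_mem hA hz]
    split_ifs <;> norm_num
  · push Not at h
    simp [structureVector_of_not_mem h]

theorem structureVector_le_one (D : TreeDraw d n) (xs : Fin n → EuclideanSpace ℝ (Fin d))
    (z : EuclideanSpace ℝ (Fin d)) (k : Fin n) : structureVector D xs z k ≤ 1 :=
  (Finset.single_le_sum (fun i _ => structureVector_nonneg D xs z i) (Finset.mem_univ k)).trans
    (sum_structureVector_le_one D xs z)

/-- Relabelling the sample points without changing the leaf that they lie in. -/
theorem structureVector_map_perm (q : TreeStructure d) (w : Finset (Fin n)) (τ : Equiv.Perm (Fin n))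
    {xs : Fin n → EuclideanSpace ℝ (Fin d)}
    (hτ : ∀ i, ∀ A ∈ q.leaves, xs (τ i) ∈ A ↔ xs i ∈ A) (z : EuclideanSpace ℝ (Fin d)) (k : Fin n) :
    structureVector ⟨q, w.map τ.toEmbedding⟩ xs z (τ k) = structureVector ⟨q, w⟩ xs z k := by
  classical
  by_cases h : ∃ A ∈ q.leaves, z ∈ A
  · obtain ⟨A, hA, hz⟩ := h
    rw [structureVector_of_mem (D := ⟨q, w.map τ.toEmbedding⟩) hA hz,
      structureVector_of_mem (D := ⟨q, w⟩) hA hz]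
    have hi : ∀ i, A.indicator (1 : EuclideanSpace ℝ (Fin d) → ℝ) (xs (τ i)) = A.indicator 1 (xs i) := by
      intro i
      by_cases h1 : xs i ∈ A
      · simp [h1, (hτ i A hA).mpr h1]
      · simp [h1, mt (hτ i A hA).mp h1]
    simp [hi]
  · push Not at h
    rw [structureVector_of_not_mem (D := ⟨q, w.map τ.toEmbedding⟩) h,
      structureVector_of_not_mem (D := ⟨q, w⟩) h]

theorem structureVector_congr_point (D : TreeDraw d n) (xs : Fin n → EuclideanSpace ℝ (Fin d))
    {z z' : EuclideanSpace ℝ (Fin d)} (h : ∀ A ∈ D.tree.leaves, z ∈ A ↔ z' ∈ A) (k : Fin n) :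
    structureVector D xs z k = structureVector D xs z' k := by
  classical
  unfold structureVector
  refine Finset.sum_congr rfl fun A hA => ?_
  simp only [h A hA]

end StructureVector

/-! ### The law of a draw; symmetry and norm bounds for `K_n` and `r_n`. -/

section DrawLaw

variable {d n : ℕ}

theorem uniformSubsample_map_perm (m : ℕ) (h : m ≤ n) (w : Finset (Fin n))
    (τ : Equiv.Perm (Fin n)) :
    uniformSubsample n m h (w.map τ.toEmbedding) = uniformSubsample n m h w := by
  unfold uniformSubsample
  simp [PMF.uniformOfFinset_apply, Finset.mem_powersetCard]

/-- The mean over the subsample of an entry of the structure vector, for a fixed tree. -/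
noncomputable def subsampleMean (m : ℕ) (h : m ≤ n) (q : TreeStructure d)
    (xs : Fin n → EuclideanSpace ℝ (Fin d)) (z : EuclideanSpace ℝ (Fin d)) (k : Fin n) : ℝ :=
  ∑ w, (uniformSubsample n m h w).toReal * structureVector ⟨q, w⟩ xs z k

theorem subsampleMean_perm (m : ℕ) (h : m ≤ n) (q : TreeStructure d) (τ : Equiv.Perm (Fin n))
    {xs : Fin n → EuclideanSpace ℝ (Fin d)}
    (hτ : ∀ i, ∀ A ∈ q.leaves, xs (τ i) ∈ A ↔ xs i ∈ A) (z : EuclideanSpace ℝ (Fin d)) (k : Fin n) :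
    subsampleMean m h q xs z (τ k) = subsampleMean m h q xs z k := by
  unfold subsampleMean
  rw [← Equiv.sum_comp τ.finsetCongr]
  refine Finset.sum_congr rfl fun w _ => ?_
  simp only [Equiv.finsetCongr_apply]
  rw [uniformSubsample_map_perm, structureVector_map_perm q w τ hτ]

/-- Sample points in the same leaf have the same mean weight. -/
theorem subsampleMean_eq_of_same_leaf (m : ℕ) (h : m ≤ n) (q : TreeStructure d)
    {xs : Fin n → EuclideanSpace ℝ (Fin d)} (z : EuclideanSpace ℝ (Fin d)) {i j : Fin n}
    (hij : ∀ A ∈ q.leaves, xs i ∈ A ↔ xs j ∈ A) :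
    subsampleMean m h q xs z i = subsampleMean m h q xs z j := by
  -- The uniform subsample is exchangeable, so transposing two sample points of one leaf changes
  -- nothing.
  have := subsampleMean_perm m h q (Equiv.swap i j) (xs := xs) ?_ z j
  · simpa using this
  · intro l A hA
    rcases eq_or_ne l i with rfl | hi
    · simpa using (hij A hA).symm
    · rcases eq_or_ne l j with rfl | hj
      · simpa using hij A hA
      · rw [Equiv.swap_apply_of_ne_of_ne hi hj]

theorem subsampleMean_nonneg (m : ℕ) (h : m ≤ n) (q : TreeStructure d)
    (xs : Fin n → EuclideanSpace ℝ (Fin d)) (z : EuclideanSpace ℝ (Fin d)) (k : Fin n) :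
    0 ≤ subsampleMean m h q xs z k :=
  Finset.sum_nonneg fun _ _ => mul_nonneg ENNReal.toReal_nonneg (structureVector_nonneg _ _ _ _)

theorem PMF.sum_toReal_eq_one {β : Type*} (p : PMF β) (s : Finset β) (hs : p.support ⊆ s) :
    ∑ a ∈ s, (p a).toReal = 1 := by
  have h : ∑' a, p a = ∑ a ∈ s, p a :=
    tsum_eq_sum fun a ha => (p.apply_eq_zero_iff a).mpr fun h => ha (hs h)
  rw [← ENNReal.toReal_sum fun a _ => p.apply_ne_top a, ← h, p.tsum_coe, ENNReal.toReal_one]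

theorem sum_uniformSubsample (m : ℕ) (h : m ≤ n) :
    ∑ w, (uniformSubsample n m h w).toReal = 1 :=
  PMF.sum_toReal_eq_one _ _ (by simp)

theorem sum_subsampleMean_le_one (m : ℕ) (h : m ≤ n) (q : TreeStructure d)
    (xs : Fin n → EuclideanSpace ℝ (Fin d)) (z : EuclideanSpace ℝ (Fin d)) :
    ∑ k, subsampleMean m h q xs z k ≤ 1 := by
  unfold subsampleMean
  rw [Finset.sum_comm, ← sum_uniformSubsample m h]
  refine Finset.sum_le_sum fun w _ => ?_
  rw [← Finset.mul_sum]
  exact mul_le_of_le_one_right ENNReal.toReal_nonneg (sum_structureVector_le_one _ _ _)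

namespace TreeScheme

variable (S : TreeScheme d)

theorem drawLaw_apply (xs : Fin n → EuclideanSpace ℝ (Fin d)) (q : TreeStructure d)
    (w : Finset (Fin n)) :
    S.drawLaw n xs ⟨q, w⟩ = S.law n xs q * uniformSubsample n (S.m n) (S.m_le n) w := by
  classical
  unfold drawLaw
  rw [PMF.bind_apply, tsum_eq_single q]
  · congr 1
    rw [PMF.map_apply, tsum_eq_single w]
    · simp
    · intro w' hw'
      simp [Ne.symm hw']
  · intro q' hq'
    refine mul_eq_zero_of_right _ ?_
    rw [PMF.map_apply, ENNReal.tsum_eq_zero]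
    intro w'
    simp [Ne.symm hq']

/-- The law charges only trees in the finite set `Q n`; boundedness of `g` supplies integrability,
so the integral is a finite sum. -/
theorem integral_drawLaw (xs : Fin n → EuclideanSpace ℝ (Fin d)) (g : TreeDraw d n → ℝ)
    (hg : ∃ C, ∀ D, |g D| ≤ C) :
    ∫ D, g D ∂(S.drawLaw n xs).toMeasure =
      ∑ q ∈ S.Q n, (S.law n xs q).toReal *
        ∑ w, (uniformSubsample n (S.m n) (S.m_le n) w).toReal * g ⟨q, w⟩ := by
  classical
  obtain ⟨C, hC⟩ := hg
  rw [PMF.integral_eq_tsum _ _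
    (Integrable.of_bound (measurable_from_top.aestronglyMeasurable) C (.of_forall hC))]
  let emb : TreeStructure d × Finset (Fin n) ↪ TreeDraw d n :=
    ⟨fun p => ⟨p.1, p.2⟩, fun p p' h => by
      simp only [TreeDraw.mk.injEq] at h
      exact Prod.ext h.1 h.2⟩
  rw [tsum_eq_sum (s := (S.Q n ×ˢ Finset.univ).map emb)]
  · rw [Finset.sum_map, Finset.sum_product]
    refine Finset.sum_congr rfl fun q _ => ?_
    rw [Finset.mul_sum]
    refine Finset.sum_congr rfl fun w _ => ?_
    change (S.drawLaw n xs ⟨q, w⟩).toReal • g ⟨q, w⟩ = _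
    rw [drawLaw_apply, ENNReal.toReal_mul, smul_eq_mul, mul_assoc]
  · rintro ⟨q, w⟩ hD
    have hq : q ∉ S.Q n := by
      intro hq
      exact hD (Finset.mem_map.mpr ⟨(q, w), by simp [hq], rfl⟩)
    have : S.law n xs q = 0 :=
      (PMF.apply_eq_zero_iff _ _).mpr fun h => hq (S.support_law n xs h)
    simp [drawLaw_apply, this]

theorem sum_law (xs : Fin n → EuclideanSpace ℝ (Fin d)) :
    ∑ q ∈ S.Q n, (S.law n xs q).toReal = 1 :=
  PMF.sum_toReal_eq_one _ _ (S.support_law n xs)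

theorem kVec_eq_sum (xs : Fin n → EuclideanSpace ℝ (Fin d)) (z : EuclideanSpace ℝ (Fin d))
    (i : Fin n) :
    S.kVec n xs z i =
      ∑ q ∈ S.Q n, (S.law n xs q).toReal * subsampleMean (S.m n) (S.m_le n) q xs z i :=
  S.integral_drawLaw xs _ ⟨1, fun D => by
    rw [abs_of_nonneg (structureVector_nonneg _ _ _ _)]
    exact structureVector_le_one _ _ _ _⟩

theorem kMat_apply (xs : Fin n → EuclideanSpace ℝ (Fin d)) (i j : Fin n) :
    S.kMat n xs i j = S.kVec n xs (xs i) j := rfl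

theorem kVec_nonneg (xs : Fin n → EuclideanSpace ℝ (Fin d)) (z : EuclideanSpace ℝ (Fin d))
    (i : Fin n) : 0 ≤ S.kVec n xs z i :=
  integral_nonneg fun _ => structureVector_nonneg _ _ _ _

theorem sum_kVec_le_one (xs : Fin n → EuclideanSpace ℝ (Fin d)) (z : EuclideanSpace ℝ (Fin d)) :
    ∑ i, S.kVec n xs z i ≤ 1 := by
  simp_rw [kVec_eq_sum]
  rw [Finset.sum_comm, ← S.sum_law xs]
  refine Finset.sum_le_sum fun q _ => ?_
  rw [← Finset.mul_sum]
  exact mul_le_of_le_one_right ENNReal.toReal_nonneg (sum_subsampleMean_le_one _ _ _ _ _)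

/-- Tree by tree: for two points in one leaf both entries are the common mean weight of that leaf,
and for points in different leaves both vanish. Symmetry is what turns the bound on row sums into
one on column sums. -/
theorem kMat_symm (xs : Fin n → EuclideanSpace ℝ (Fin d)) (i j : Fin n) :
    S.kMat n xs i j = S.kMat n xs j i := by
  simp_rw [kMat_apply, kVec_eq_sum]
  refine Finset.sum_congr rfl fun q _ => ?_
  congr 1
  by_cases hij : ∀ A ∈ q.leaves, xs i ∈ A ↔ xs j ∈ A
  · rw [← subsampleMean_eq_of_same_leaf _ _ q (xs i) hij]
    unfold subsampleMean
    refine Finset.sum_congr rfl fun w _ => ?_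
    rw [structureVector_congr_point ⟨q, w⟩ xs hij]
  · have key : ∀ a b : Fin n, ¬ (∀ A ∈ q.leaves, xs a ∈ A ↔ xs b ∈ A) →
        subsampleMean (S.m n) (S.m_le n) q xs (xs a) b = 0 := by
      intro a b hab
      unfold subsampleMean
      refine Finset.sum_eq_zero fun w _ => ?_
      by_cases h : ∃ A ∈ q.leaves, xs a ∈ A
      · obtain ⟨A, hA, ha⟩ := h
        have hb : xs b ∉ A := by
          intro hb
          refine hab fun B hB => ?_
          rcases eq_or_ne A B with rfl | hne
          · simp [ha, hb]
          · have hd := Set.disjoint_left.mp (q.disjoint A hA B hB hne)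
            simp [hd ha, hd hb]
        rw [structureVector_of_mem (D := ⟨q, w⟩) hA ha]
        simp [hb]
      · push Not at h
        rw [structureVector_of_not_mem (D := ⟨q, w⟩) h, mul_zero]
    rw [key i j hij, key j i fun h => hij fun A hA => (h A hA).symm]

theorem sum_kMat_row_le_one (xs : Fin n → EuclideanSpace ℝ (Fin d)) (i : Fin n) :
    ∑ j, S.kMat n xs i j ≤ 1 := S.sum_kVec_le_one xs (xs i)

theorem sum_kMat_col_le_one (xs : Fin n → EuclideanSpace ℝ (Fin d)) (j : Fin n) :
    ∑ i, S.kMat n xs i j ≤ 1 := by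
  simp_rw [S.kMat_symm xs _ j]
  exact S.sum_kMat_row_le_one xs j

theorem kMat_nonneg (xs : Fin n → EuclideanSpace ℝ (Fin d)) (i j : Fin n) :
    0 ≤ S.kMat n xs i j := S.kVec_nonneg xs (xs i) j

/-- The matrix is strictly diagonally dominant: the off-diagonal row sum is at most `1`, and `1 <
1/λ`. -/
theorem isUnit_det_regularized {lam : ℝ} (hlam0 : 0 < lam) (hlam1 : lam < 1)
    (xs : Fin n → EuclideanSpace ℝ (Fin d)) :
    IsUnit ((1 / lam) • (1 : Matrix (Fin n) (Fin n) ℝ) + S.kMat n xs).det := by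
  refine isUnit_iff_ne_zero.mpr (det_ne_zero_of_sum_row_lt_diag fun k => ?_)
  have h1 : 1 < 1 / lam := by rw [lt_div_iff₀ hlam0]; linarith
  have hrow := S.sum_kMat_row_le_one xs k
  rw [← Finset.add_sum_erase _ _ (Finset.mem_univ k)] at hrow
  have hnn := S.kMat_nonneg xs
  have hd : ((1 / lam) • (1 : Matrix (Fin n) (Fin n) ℝ) + S.kMat n xs) k k =
      1 / lam + S.kMat n xs k k := by simp
  rw [hd, Real.norm_of_nonneg (by have := hnn k k; linarith)]
  have : ∑ j ∈ Finset.univ.erase k,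
      ‖((1 / lam) • (1 : Matrix (Fin n) (Fin n) ℝ) + S.kMat n xs) k j‖ =
      ∑ j ∈ Finset.univ.erase k, S.kMat n xs k j := by
    refine Finset.sum_congr rfl fun j hj => ?_
    rw [Matrix.add_apply, Matrix.smul_apply, Matrix.one_apply_ne (Finset.ne_of_mem_erase hj).symm,
      smul_zero, zero_add, Real.norm_of_nonneg (hnn k j)]
  rw [this]
  have := hnn k k
  linarith

/-- The defining equation of `r_n`, entry by entry. -/
theorem rVec_equation {lam : ℝ} (hlam0 : 0 < lam) (hlam1 : lam < 1)
    (xs : Fin n → EuclideanSpace ℝ (Fin d)) (z : EuclideanSpace ℝ (Fin d)) (j : Fin n) :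
    (1 / lam) * S.rVec lam n xs z j + ∑ i, S.rVec lam n xs z i * S.kMat n xs i j =
      S.kVec n xs z j := by
  have h : S.rVec lam n xs z ᵥ* ((1 / lam) • (1 : Matrix (Fin n) (Fin n) ℝ) + S.kMat n xs) =
      S.kVec n xs z := by
    unfold rVec
    rw [Matrix.vecMul_vecMul, Matrix.nonsing_inv_mul _ (S.isUnit_det_regularized hlam0 hlam1 xs),
      Matrix.vecMul_one]
  have h' := congrFun h j
  rw [Matrix.vecMul_add, Matrix.vecMul_smul, Matrix.vecMul_one] at h'
  simpa [Matrix.vecMul, dotProduct] using h'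

/-- If the entries of `k_n` are at most `B` then those of `r_n` are at most `λ B / (1 - λ)`. -/
theorem abs_rVec_le {lam : ℝ} (hlam0 : 0 < lam) (hlam1 : lam < 1)
    (xs : Fin n → EuclideanSpace ℝ (Fin d)) (z : EuclideanSpace ℝ (Fin d)) {B : ℝ}
    (hB : ∀ i, S.kVec n xs z i ≤ B) (j : Fin n) :
    |S.rVec lam n xs z j| ≤ lam / (1 - lam) * B := by
  -- At an entry of largest modulus the term `∑ r_i K_il` is at most `|r_l|`, by the column sums;
  -- hence `(1/λ - 1) |r_l| ≤ B`.
  obtain ⟨l, -, hl⟩ := Finset.exists_max_image Finset.univ (fun i => |S.rVec lam n xs z i|)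
    ⟨j, Finset.mem_univ j⟩
  refine (hl j (Finset.mem_univ j)).trans ?_
  set r := S.rVec lam n xs z
  have heq := S.rVec_equation hlam0 hlam1 xs z l
  have hsum : |∑ i, r i * S.kMat n xs i l| ≤ |r l| := by
    calc |∑ i, r i * S.kMat n xs i l| ≤ ∑ i, |r i * S.kMat n xs i l| :=
          Finset.abs_sum_le_sum_abs _ _
      _ ≤ ∑ i, |r l| * S.kMat n xs i l := by
          refine Finset.sum_le_sum fun i _ => ?_
          rw [abs_mul, abs_of_nonneg (S.kMat_nonneg xs i l)]
          exact mul_le_mul_of_nonneg_right (hl i (Finset.mem_univ i)) (S.kMat_nonneg xs i l)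
      _ ≤ |r l| := by
          rw [← Finset.mul_sum]
          exact mul_le_of_le_one_right (abs_nonneg _) (S.sum_kMat_col_le_one xs l)
  have hk : |S.kVec n xs z l| ≤ B := by
    rw [abs_of_nonneg (S.kVec_nonneg xs z l)]
    exact hB l
  have h1 : (1 / lam) * |r l| ≤ B + |r l| := by
    have : (1 / lam) * r l = S.kVec n xs z l - ∑ i, r i * S.kMat n xs i l := by linarith
    calc (1 / lam) * |r l| = |(1 / lam) * r l| := by
          rw [abs_mul, abs_of_pos (by positivity : 0 < 1 / lam)]
      _ ≤ |S.kVec n xs z l| + |∑ i, r i * S.kMat n xs i l| := by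
          rw [this]
          exact abs_sub _ _
      _ ≤ B + |r l| := add_le_add hk hsum
  have h2 : |r l| ≤ lam * (B + |r l|) := by
    calc |r l| = lam * ((1 / lam) * |r l|) := by field_simp
      _ ≤ _ := mul_le_mul_of_nonneg_left h1 hlam0.le
  rw [div_mul_eq_mul_div, le_div_iff₀ (by linarith)]
  linarith

/-- The Euclidean norm of `r_n` is at least a constant times that of `k_n`. -/
theorem sum_sq_kVec_le {lam : ℝ} (hlam0 : 0 < lam) (hlam1 : lam < 1)
    (xs : Fin n → EuclideanSpace ℝ (Fin d)) (z : EuclideanSpace ℝ (Fin d)) :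
    ∑ j, S.kVec n xs z j ^ 2 ≤ 2 * ((1 / lam) ^ 2 + 1) * ∑ j, S.rVec lam n xs z j ^ 2 := by
  set r := S.rVec lam n xs z
  -- Schur test: Cauchy–Schwarz with weights `K_ij` uses the column sums, and exchanging the sums
  -- then uses the row sums.
  have hschur : ∑ j, (∑ i, r i * S.kMat n xs i j) ^ 2 ≤ ∑ j, r j ^ 2 := by
    calc ∑ j, (∑ i, r i * S.kMat n xs i j) ^ 2
        ≤ ∑ j, ∑ i, r i ^ 2 * S.kMat n xs i j := by
          refine Finset.sum_le_sum fun j _ => ?_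
          have hcs := Finset.sum_sq_le_sum_mul_sum_of_sq_le_mul Finset.univ
            (r := fun i => r i * S.kMat n xs i j) (f := fun i => S.kMat n xs i j)
            (g := fun i => r i ^ 2 * S.kMat n xs i j)
            (fun i _ => S.kMat_nonneg xs i j)
            (fun i _ => mul_nonneg (sq_nonneg _) (S.kMat_nonneg xs i j))
            (fun i _ => le_of_eq (by ring))
          refine hcs.trans (mul_le_of_le_one_left ?_ (S.sum_kMat_col_le_one xs j))
          exact Finset.sum_nonneg fun i _ => mul_nonneg (sq_nonneg _) (S.kMat_nonneg xs i j)
      _ = ∑ i, r i ^ 2 * ∑ j, S.kMat n xs i j := by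
          rw [Finset.sum_comm]
          simp_rw [Finset.mul_sum]
      _ ≤ ∑ i, r i ^ 2 := Finset.sum_le_sum fun i _ =>
          mul_le_of_le_one_right (sq_nonneg _) (S.sum_kMat_row_le_one xs i)
  calc ∑ j, S.kVec n xs z j ^ 2
      ≤ ∑ j, (2 * (1 / lam) ^ 2 * r j ^ 2 + 2 * (∑ i, r i * S.kMat n xs i j) ^ 2) := by
        refine Finset.sum_le_sum fun j _ => ?_
        rw [← S.rVec_equation hlam0 hlam1 xs z j]
        nlinarith [sq_nonneg ((1 / lam) * r j - ∑ i, r i * S.kMat n xs i j)]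
    _ = 2 * (1 / lam) ^ 2 * ∑ j, r j ^ 2 + 2 * ∑ j, (∑ i, r i * S.kMat n xs i j) ^ 2 := by
        rw [Finset.sum_add_distrib, ← Finset.mul_sum, ← Finset.mul_sum]
    _ ≤ _ := by nlinarith [hschur]

end TreeScheme

end DrawLaw

/-! ### Sequences dominated by their running means. -/

section Contraction

/-- A bounded sequence that is eventually dominated by `λ` times its running mean, up to an error
that vanishes, tends to zero. -/
theorem tendsto_zero_of_le_mul_average {u ε : ℕ → ℝ} {lam B : ℝ} (hlam0 : 0 < lam) (hlam1 : lam < 1)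
    (hu0 : ∀ b, 0 ≤ u b) (huB : ∀ b, u b ≤ B) (hε : Tendsto ε atTop (𝓝 0))
    (hle : ∀ᶠ b : ℕ in atTop, u b ≤ ε b + lam * ((∑ a ∈ Finset.range b, u a) / b)) :
    Tendsto u atTop (𝓝 0) := by
  have hB : 0 ≤ B := (hu0 0).trans (huB 0)
  -- Any eventual bound `C` improves by the factor `(1+λ)/2`. The initial segment is negligible in
  -- the mean, and the slack `(1-λ)/2 * C` absorbs it together with the error `ε`.
  have step : ∀ C, 0 < C → (∀ᶠ b in atTop, u b ≤ C) →
      ∀ᶠ b in atTop, u b ≤ (1 + lam) / 2 * C := by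
    intro C hC h
    obtain ⟨b₀, hb₀⟩ := eventually_atTop.mp h
    have herr : Tendsto (fun b : ℕ => ε b + lam * ((b₀ * B) / b)) atTop (𝓝 0) := by
      simpa using hε.add ((tendsto_const_div_atTop_nhds_zero_nat (b₀ * B)).const_mul lam)
    have hgap : 0 < (1 - lam) / 2 * C := mul_pos (by linarith) hC
    filter_upwards [hle, herr.eventually (eventually_le_nhds hgap), eventually_gt_atTop 0,
      eventually_ge_atTop b₀] with b h1 h2 h3 h4
    have hb : (0 : ℝ) < b := by exact_mod_cast h3
    have hsum : ∑ a ∈ Finset.range b, u a ≤ b₀ * B + b * C := by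
      rw [← Finset.sum_range_add_sum_Ico _ h4]
      refine add_le_add ?_ ?_
      · simpa using Finset.sum_le_sum (s := Finset.range b₀) fun a _ => huB a
      · calc ∑ a ∈ Finset.Ico b₀ b, u a ≤ ∑ a ∈ Finset.Ico b₀ b, C :=
              Finset.sum_le_sum fun a ha => hb₀ a (Finset.mem_Ico.mp ha).1
          _ ≤ b * C := by
              rw [Finset.sum_const, Nat.card_Ico, nsmul_eq_mul]
              gcongr
              exact Nat.sub_le b b₀
    have havg : (∑ a ∈ Finset.range b, u a) / b ≤ (b₀ * B) / b + C := by
      rw [div_le_iff₀ hb, add_mul, div_mul_cancel₀ _ hb.ne']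
      linarith
    have := mul_le_mul_of_nonneg_left havg hlam0.le
    linarith
  -- Starting from `B + 1` instead of `B` keeps the bound strictly positive, as `step` requires.
  have iter : ∀ k : ℕ, ∀ᶠ b in atTop, u b ≤ ((1 + lam) / 2) ^ k * (B + 1) := by
    intro k
    induction k with
    | zero => exact .of_forall fun b => by simpa using (huB b).trans (by linarith)
    | succ k ih =>
      have := step _ (mul_pos (pow_pos (by linarith) k) (by linarith)) ih
      simpa [pow_succ, mul_comm, mul_assoc, mul_left_comm] using this
  have hpow : Tendsto (fun k : ℕ => ((1 + lam) / 2) ^ k * (B + 1)) atTop (𝓝 0) := by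
    simpa using (tendsto_pow_atTop_nhds_zero_of_lt_one (r := (1 + lam) / 2) (by linarith)
      (by linarith)).mul_const (B + 1)
  rw [tendsto_order]
  refine ⟨fun a ha => .of_forall fun b => ha.trans_le (hu0 b), fun a ha => ?_⟩
  obtain ⟨k, hk⟩ := (hpow.eventually_lt_const ha).exists
  filter_upwards [iter k] with b hb
  exact hb.trans_lt hk

end Contraction

/-! ### Almost sure convergence of the Boulevard iterates for a fixed sample. -/

section Boulevard

variable {d n : ℕ} {lam : ℝ} {xs : Fin n → EuclideanSpace ℝ (Fin d)} {ys : Fin n → ℝ}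

theorem abs_sum_structureVector_mul_le (D : TreeDraw d n) (z : EuclideanSpace ℝ (Fin d))
    {v : Fin n → ℝ} {C : ℝ} (hC : 0 ≤ C) (hv : ∀ k, |v k| ≤ C) :
    |∑ k, structureVector D xs z k * v k| ≤ C := by
  calc |∑ k, structureVector D xs z k * v k| ≤ ∑ k, |structureVector D xs z k * v k| :=
        Finset.abs_sum_le_sum_abs _ _
    _ ≤ ∑ k, structureVector D xs z k * C := by
        refine Finset.sum_le_sum fun k _ => ?_
        rw [abs_mul, abs_of_nonneg (structureVector_nonneg D xs z k)]
        exact mul_le_mul_of_nonneg_left (hv k) (structureVector_nonneg D xs z k)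
    _ ≤ C := by
        rw [← Finset.sum_mul]
        exact mul_le_of_le_one_left hC (sum_structureVector_le_one D xs z)

/-- The Boulevard iterates stay bounded. -/
theorem abs_boulevard_le (hlam0 : 0 < lam) (hlam1 : lam < 1) {Y : ℝ} (hY0 : 0 ≤ Y)
    (hY : ∀ k, |ys k| ≤ Y) (D : ℕ → TreeDraw d n) (b : ℕ) (z : EuclideanSpace ℝ (Fin d)) :
    |boulevard lam id xs ys D b z| ≤ lam * Y / (1 - lam) := by
  set B := lam * Y / (1 - lam) with hBdef
  have h1l : 0 < 1 - lam := by linarith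
  have hB0 : 0 ≤ B := by positivity
  -- `B` is chosen as the fixed point of this equation, so that the bound reproduces itself in the
  -- induction.
  have hBeq : lam * (Y + B) = B := by
    have : B * (1 - lam) = lam * Y := by rw [hBdef]; field_simp
    linarith
  induction b generalizing z with
  | zero => simpa [boulevard] using hB0
  | succ b ih =>
    have hb : (0 : ℝ) < (b : ℝ) + 1 := by positivity
    have hs := abs_sum_structureVector_mul_le (xs := xs) (D b) z (C := Y + B) (by positivity)
      (v := fun k => ys k - id (boulevard lam id xs ys D b (xs k)))
      (fun k => (abs_sub _ _).trans (add_le_add (hY k) (ih (xs k))))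
    simp only [boulevard]
    refine (abs_add_le _ _).trans ?_
    rw [abs_mul, abs_mul, abs_of_nonneg (by positivity : 0 ≤ (b : ℝ) / ((b : ℝ) + 1)),
      abs_of_nonneg (by positivity : 0 ≤ lam / ((b : ℝ) + 1))]
    calc _ ≤ (b : ℝ) / ((b : ℝ) + 1) * B + lam / ((b : ℝ) + 1) * (Y + B) := by
          gcongr
          exact ih z
      _ = ((b : ℝ) * B + lam * (Y + B)) / ((b : ℝ) + 1) := by ring
      _ = B := by rw [hBeq]; field_simp

theorem truncation_eq_self {M u : ℝ} (h : |u| ≤ M) : truncation M u = u := by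
  rw [_root_.truncation, min_eq_left h]
  rcases lt_trichotomy u 0 with hu | rfl | hu
  · rw [Real.sign_of_neg hu, abs_of_neg hu]
    ring
  · simp
  · rw [Real.sign_of_pos hu, abs_of_pos hu, one_mul]

/-- Truncation at a high level does not change the Boulevard iterates. -/
theorem boulevard_truncation_eq (hlam0 : 0 < lam) (hlam1 : lam < 1) {Y M : ℝ} (hY0 : 0 ≤ Y)
    (hY : ∀ k, |ys k| ≤ Y) (hM : lam * Y / (1 - lam) ≤ M) (D : ℕ → TreeDraw d n) (b : ℕ) :
    boulevard lam (truncation M) xs ys D b = boulevard lam id xs ys D b := by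
  induction b with
  | zero => rfl
  | succ b ih =>
    funext z
    simp only [boulevard, ih]
    congr 3
    funext k
    rw [truncation_eq_self ((abs_boulevard_le hlam0 hlam1 hY0 hY D b (xs k)).trans hM), id]

/-- Multiplied by `b + 1`, the recursion telescopes. The iterate becomes `λ` times a running mean of
fitted residuals, to which the strong law and the contraction lemma apply. -/
theorem mul_boulevard_eq_sum (D : ℕ → TreeDraw d n) (b : ℕ) (z : EuclideanSpace ℝ (Fin d)) :
    (b : ℝ) * boulevard lam id xs ys D b z = lam * ∑ a ∈ Finset.range b,
      ∑ k, structureVector (D a) xs z k * (ys k - boulevard lam id xs ys D a (xs k)) := by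
  induction b with
  | zero => simp
  | succ b ih =>
    rw [Finset.sum_range_succ, mul_add, ← ih]
    simp only [boulevard, id]
    have hb : (b : ℝ) + 1 ≠ 0 := by positivity
    push_cast
    field_simp

/-- Convergence of the Boulevard iterates along any sequence of draws for which the running means of
the structure vectors at the sample points and at `x` converge. -/
theorem tendsto_boulevard_of_tendsto_average (hlam0 : 0 < lam) (hlam1 : lam < 1)
    (D : ℕ → TreeDraw d n) (κ : EuclideanSpace ℝ (Fin d) → Fin n → ℝ) (g : Fin n → ℝ)
    (hg : ∀ i, g i + lam * ∑ k, κ (xs i) k * g k = ys i) (x : EuclideanSpace ℝ (Fin d))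
    (havg : ∀ z, (z = x ∨ ∃ i, z = xs i) → ∀ k, Tendsto (fun b : ℕ =>
      (∑ a ∈ Finset.range b, structureVector (D a) xs z k) / b) atTop (𝓝 (κ z k))) :
    Tendsto (fun b => boulevard lam id xs ys D b x) atTop (𝓝 (lam * ∑ k, κ x k * g k)) := by
  set F := boulevard lam id xs ys D with hF
  set G : EuclideanSpace ℝ (Fin d) → ℝ := fun z => lam * ∑ k, κ z k * g k with hG
  obtain ⟨Y, hY0, hY⟩ : ∃ Y : ℝ, 0 ≤ Y ∧ ∀ k, |ys k| ≤ Y :=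
    ⟨∑ k, |ys k|, Finset.sum_nonneg fun _ _ => abs_nonneg _,
      fun k => Finset.single_le_sum (f := fun k => |ys k|) (fun _ _ => abs_nonneg _)
        (Finset.mem_univ k)⟩
  set u : ℕ → ℝ := fun b => ‖fun i : Fin n => F b (xs i) - G (xs i)‖ with hu
  have hu_le : ∀ b i, |F b (xs i) - G (xs i)| ≤ u b := fun b i =>
    norm_le_pi_norm (fun i : Fin n => F b (xs i) - G (xs i)) i
  set err : EuclideanSpace ℝ (Fin d) → ℕ → ℝ := fun z b => |lam * ∑ k,
    ((∑ a ∈ Finset.range b, structureVector (D a) xs z k) / b - κ z k) * g k| with herr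
  have herr0 : ∀ z, (z = x ∨ ∃ i, z = xs i) → Tendsto (err z) atTop (𝓝 0) := by
    intro z hz
    have : Tendsto (fun b : ℕ => lam * ∑ k,
        ((∑ a ∈ Finset.range b, structureVector (D a) xs z k) / b - κ z k) * g k) atTop
        (𝓝 (lam * ∑ k, (κ z k - κ z k) * g k)) :=
      (tendsto_finsetSum _ fun k _ => ((havg z hz k).sub_const _).mul_const _).const_mul _
    have h := this.abs
    simp only [sub_self, zero_mul, Finset.sum_const_zero, mul_zero, abs_zero] at h
    exact h
  -- Since `y_k = g_k + G(x_k)`, each residual is `g_k` minus the current error at `x_k`. The first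
  -- part averages to `G`, up to `err`; the second is controlled by the running mean of the sup-norm
  -- errors `u`.
  have hkey : ∀ z, ∀ b : ℕ, 0 < b →
      |F b z - G z| ≤ err z b + lam * ((∑ a ∈ Finset.range b, u a) / b) := by
    intro z b hb
    have hb' : (0 : ℝ) < b := by exact_mod_cast hb
    have h1 := mul_boulevard_eq_sum (lam := lam) (xs := xs) (ys := ys) D b z
    rw [← hF] at h1
    have h2 : F b z - G z = lam * ∑ k,
        ((∑ a ∈ Finset.range b, structureVector (D a) xs z k) / b - κ z k) * g k -
        lam * ((∑ a ∈ Finset.range b,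
          ∑ k, structureVector (D a) xs z k * (F a (xs k) - G (xs k))) / b) := by
      have h3 : ∀ a, ∑ k, structureVector (D a) xs z k * (ys k - F a (xs k)) =
          ∑ k, structureVector (D a) xs z k * g k -
            ∑ k, structureVector (D a) xs z k * (F a (xs k) - G (xs k)) := by
        intro a
        rw [← Finset.sum_sub_distrib]
        refine Finset.sum_congr rfl fun k _ => ?_
        rw [← hg k]
        ring
      simp_rw [h3] at h1
      rw [Finset.sum_sub_distrib] at h1
      have h4 : ∑ a ∈ Finset.range b, ∑ k, structureVector (D a) xs z k * g k =
          ∑ k, (∑ a ∈ Finset.range b, structureVector (D a) xs z k) * g k := by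
        rw [Finset.sum_comm]
        simp_rw [Finset.sum_mul]
      rw [h4] at h1
      have h5 : F b z = lam * (∑ k, (∑ a ∈ Finset.range b, structureVector (D a) xs z k) * g k -
          ∑ a ∈ Finset.range b,
            ∑ k, structureVector (D a) xs z k * (F a (xs k) - G (xs k))) / b := by
        rw [eq_div_iff hb'.ne', mul_comm, h1]
      rw [h5]
      simp only [sub_mul, div_mul_eq_mul_div, Finset.sum_sub_distrib, ← Finset.sum_div, hG]
      ring
    rw [h2]
    refine (abs_sub _ _).trans (add_le_add le_rfl ?_)
    rw [abs_mul, abs_of_pos hlam0, abs_div, abs_of_pos hb']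
    gcongr
    refine (Finset.abs_sum_le_sum_abs _ _).trans (Finset.sum_le_sum fun a _ => ?_)
    exact abs_sum_structureVector_mul_le (D a) z (norm_nonneg _) (hu_le a)
  have hu0 : Tendsto u atTop (𝓝 0) := by
    refine tendsto_zero_of_le_mul_average (B := lam * Y / (1 - lam) + ‖fun i => G (xs i)‖)
      (ε := fun b => ∑ i, err (xs i) b) hlam0 hlam1 (fun b => norm_nonneg _) (fun b => ?_) ?_ ?_
    · refine (norm_sub_le (fun i : Fin n => F b (xs i)) (fun i => G (xs i))).trans ?_
      have h1l : 0 < 1 - lam := by linarith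
      refine add_le_add ((pi_norm_le_iff_of_nonneg (by positivity)).mpr fun i => ?_) le_rfl
      exact abs_boulevard_le hlam0 hlam1 hY0 hY D b (xs i)
    · simpa using tendsto_finsetSum Finset.univ fun i _ => herr0 (xs i) (.inr ⟨i, rfl⟩)
    · filter_upwards [eventually_gt_atTop 0] with b hb
      have hsum0 : 0 ≤ ∑ a ∈ Finset.range b, u a := Finset.sum_nonneg fun a _ => norm_nonneg _
      have herrnn : ∀ i ∈ Finset.univ, 0 ≤ err (xs i) b := fun i _ => abs_nonneg _
      refine (pi_norm_le_iff_of_nonneg ?_).mpr fun i => ?_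
      · have := Finset.sum_nonneg herrnn
        positivity
      · refine (hkey (xs i) b hb).trans (add_le_add ?_ le_rfl)
        exact Finset.single_le_sum herrnn (Finset.mem_univ i)
  rw [tendsto_iff_norm_sub_tendsto_zero]
  -- The errors vanish at the sample points, hence so do their Cesàro means, and `hkey` carries this
  -- over to `x`.
  have hces : Tendsto (fun b : ℕ => (∑ a ∈ Finset.range b, u a) / b) atTop (𝓝 0) := by
    simpa [div_eq_inv_mul] using hu0.cesaro
  refine squeeze_zero' (.of_forall fun _ => norm_nonneg _) ?_
    (by simpa using (herr0 x (.inl rfl)).add (hces.const_mul lam))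
  filter_upwards [eventually_gt_atTop 0] with b hb
  exact hkey x b hb

variable (S : TreeScheme d)

/-- Non-adaptivity enters here: given the sample, the draws are i.i.d. across iterations, so the
strong law applies to each entry. -/
theorem ae_tendsto_average_structureVector (xs : Fin n → EuclideanSpace ℝ (Fin d))
    (z : EuclideanSpace ℝ (Fin d)) (k : Fin n) :
    ∀ᵐ D ∂(S.drawSeqLaw n xs), Tendsto (fun b : ℕ =>
      (∑ a ∈ Finset.range b, structureVector (D a) xs z k) / b) atTop (𝓝 (S.kVec n xs z k)) := by
  set μ := (S.drawLaw n xs).toMeasure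
  have hmeas : Measurable fun D : TreeDraw d n => structureVector D xs z k := measurable_from_top
  have heval : ∀ i, MeasurePreserving (Function.eval i) (S.drawSeqLaw n xs) μ :=
    fun i => measurePreserving_eval_infinitePi (fun _ : ℕ => μ) i
  have hint : Integrable (fun D : TreeDraw d n => structureVector D xs z k) μ :=
    Integrable.of_bound hmeas.aestronglyMeasurable 1 (.of_forall fun D => by
      rw [Real.norm_of_nonneg (structureVector_nonneg _ _ _ _)]
      exact structureVector_le_one _ _ _ _)
  have hslln := strong_law_ae_real (μ := S.drawSeqLaw n xs)
    (fun a D => structureVector (D a) xs z k)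
    ((heval 0).integrable_comp_of_integrable hint)
    (fun i j hij => (iIndepFun_infinitePi (P := fun _ : ℕ => μ)
      (X := fun _ D => structureVector D xs z k) fun _ => hmeas).indepFun hij)
    (fun i => by
      refine ⟨(hmeas.comp (heval i).measurable).aemeasurable,
        (hmeas.comp (heval 0).measurable).aemeasurable, ?_⟩
      have h : ∀ j, (S.drawSeqLaw n xs).map (fun D => structureVector (D j) xs z k) =
          μ.map fun D => structureVector D xs z k := by
        intro j
        rw [← (heval j).map_eq, Measure.map_map hmeas (heval j).measurable]
        rfl
      rw [h i, h 0])
  have hmean : ∫ D, structureVector (D 0) xs z k ∂(S.drawSeqLaw n xs) = S.kVec n xs z k := by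
    have h := integral_map (μ := S.drawSeqLaw n xs) (heval 0).measurable.aemeasurable
      (f := fun D => structureVector D xs z k) (hmeas.aestronglyMeasurable)
    rw [(heval 0).map_eq] at h
    exact h.symm
  rw [hmean] at hslln
  exact hslln

/-- The Boulevard prediction is `r_nᵀ Y`. -/
theorem isBoulevardLimit_rVec (hlam0 : 0 < lam) (hlam1 : lam < 1)
    (xs : Fin n → EuclideanSpace ℝ (Fin d)) (ys : Fin n → ℝ) (x : EuclideanSpace ℝ (Fin d)) :
    IsBoulevardLimit S lam n xs ys x (S.rVec lam n xs x ⬝ᵥ ys) := by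
  set M := (1 / lam) • (1 : Matrix (Fin n) (Fin n) ℝ) + S.kMat n xs with hMdef
  set h : Fin n → ℝ := M⁻¹ *ᵥ ys with hh
  have hMh : M *ᵥ h = ys := by
    rw [hh, Matrix.mulVec_mulVec, Matrix.mul_nonsing_inv _ (S.isUnit_det_regularized hlam0 hlam1 xs),
      Matrix.one_mulVec]
  -- The limiting residual is `g = h / λ`, so that `(I + λ K_n) g = Y` is the equation `(λ⁻¹ I +
  -- K_n) h = Y`.
  have hgeq : ∀ i, (1 / lam) * h i + lam * ∑ k, S.kVec n xs (xs i) k * ((1 / lam) * h k) = ys i := by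
    intro i
    have h1 := congrFun hMh i
    rw [hMdef, Matrix.add_mulVec, Matrix.smul_mulVec, Matrix.one_mulVec] at h1
    simp only [Pi.add_apply, Pi.smul_apply, smul_eq_mul, Matrix.mulVec, dotProduct] at h1
    rw [← h1, Finset.mul_sum]
    congr 1
    refine Finset.sum_congr rfl fun k _ => ?_
    rw [TreeScheme.kMat_apply]
    field_simp
  have hlim : lam * ∑ k, S.kVec n xs x k * ((1 / lam) * h k) = S.rVec lam n xs x ⬝ᵥ ys := by
    have : S.rVec lam n xs x ⬝ᵥ ys = S.kVec n xs x ⬝ᵥ h := by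
      rw [TreeScheme.rVec, ← Matrix.dotProduct_mulVec]
    rw [this, dotProduct, Finset.mul_sum]
    refine Finset.sum_congr rfl fun k _ => ?_
    field_simp
  have hid : ∀ᵐ D ∂(S.drawSeqLaw n xs),
      Tendsto (fun b => boulevard lam id xs ys D b x) atTop (𝓝 (S.rVec lam n xs x ⬝ᵥ ys)) := by
    have h1 := ae_all_iff.mpr fun k => ae_tendsto_average_structureVector S xs x k
    have h2 := ae_all_iff.mpr fun i => ae_all_iff.mpr fun k =>
      ae_tendsto_average_structureVector S xs (xs i) k
    filter_upwards [h1, h2] with D hD1 hD2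
    rw [← hlim]
    refine tendsto_boulevard_of_tendsto_average hlam0 hlam1 D (S.kVec n xs)
      (fun k => (1 / lam) * h k) hgeq x ?_
    rintro z (rfl | ⟨i, rfl⟩)
    · exact hD1
    · exact hD2 i
  refine ⟨hid, ?_⟩
  have hY : ∀ k, |ys k| ≤ ∑ k, |ys k| := fun k =>
    Finset.single_le_sum (f := fun k => |ys k|) (fun _ _ => abs_nonneg _) (Finset.mem_univ k)
  filter_upwards [eventually_ge_atTop (lam * (∑ k, |ys k|) / (1 - lam))] with M hM
  filter_upwards [hid] with D hD
  simp_rw [boulevard_truncation_eq hlam0 hlam1 (Finset.sum_nonneg fun _ _ => abs_nonneg _) hY hM]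
  exact hD

end Boulevard

/-! ### A central limit theorem with random weights independent of the errors. -/

section WeightedCLT

/-- Second-order Taylor expansion at zero. It will be applied to the error law and to the Gaussian
of the same variance, whose quadratic terms cancel. -/
theorem charFun_sub_quadratic_isLittleO {μ : Measure ℝ} [IsProbabilityMeasure μ]
    (h2 : MemLp id 2 μ) (h0 : ∫ y, y ∂μ = 0) {v : ℝ} (hv : ∫ y, y ^ 2 ∂μ = v) :
    (fun t : ℝ => charFun μ t - (1 - v * t ^ 2 / 2)) =o[𝓝 0] fun t => t ^ 2 := by
  have h := taylor_isLittleO_univ (f := charFun μ) (x₀ := 0) (n := 2) (contDiff_charFun h2)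
  simp only [sub_zero] at h
  have hT : ∀ t, taylorWithinEval (charFun μ) 2 Set.univ 0 t = 1 - v * t ^ 2 / 2 := by
    intro t
    have := taylorWithinEval_charFun_two_zero (P := μ) (X := id) aemeasurable_id
      (by simpa using h2) t
    simp only [Measure.map_id, id, Pi.pow_apply, h0, hv] at this
    simpa using this
  simp_rw [hT] at h
  exact h

/-- A product of numbers in the closed unit disc depends Lipschitz-continuously on the factors. -/
theorem norm_prod_sub_prod_le {ι : Type*} (s : Finset ι) (a b : ι → ℂ)
    (ha : ∀ i ∈ s, ‖a i‖ ≤ 1) (hb : ∀ i ∈ s, ‖b i‖ ≤ 1) :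
    ‖∏ i ∈ s, a i - ∏ i ∈ s, b i‖ ≤ ∑ i ∈ s, ‖a i - b i‖ := by
  classical
  induction s using Finset.induction_on with
  | empty => simp
  | insert i s hi ih =>
    rw [Finset.prod_insert hi, Finset.prod_insert hi, Finset.sum_insert hi]
    have ha' := fun j hj => ha j (Finset.mem_insert_of_mem hj)
    have hb' := fun j hj => hb j (Finset.mem_insert_of_mem hj)
    have hpb : ‖∏ j ∈ s, b j‖ ≤ 1 := by
      rw [norm_prod]
      exact Finset.prod_le_one (fun _ _ => norm_nonneg _) hb'
    calc ‖a i * ∏ j ∈ s, a j - b i * ∏ j ∈ s, b j‖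
        = ‖(a i - b i) * ∏ j ∈ s, b j + a i * (∏ j ∈ s, a j - ∏ j ∈ s, b j)‖ := by
          congr 1
          ring
      _ ≤ ‖a i - b i‖ * ‖∏ j ∈ s, b j‖ + ‖a i‖ * ‖∏ j ∈ s, a j - ∏ j ∈ s, b j‖ := by
          refine (norm_add_le _ _).trans ?_
          rw [norm_mul, norm_mul]
      _ ≤ ‖a i - b i‖ * 1 + 1 * ∑ j ∈ s, ‖a j - b j‖ := by
          gcongr
          · exact ha i (Finset.mem_insert_self i s)
          · exact ih ha' hb'
      _ = _ := by ring

/-- The characteristic function of a sum of i.i.d. variables with normalized, uniformly small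
weights is close to that of the Gaussian. -/
theorem prod_charFun_close_gaussian {μ : Measure ℝ} [IsProbabilityMeasure μ]
    (h2 : MemLp id 2 μ) (h0 : ∫ y, y ∂μ = 0) {v : ℝ≥0} (hv : ∫ y, y ^ 2 ∂μ = v)
    (t : ℝ) {η : ℝ} (hη : 0 < η) :
    ∃ δ > 0, ∀ (n : ℕ) (a : Fin n → ℝ), ∑ i, a i ^ 2 = 1 → (∀ i, |a i| ≤ δ) →
      ‖∏ i, charFun μ (t * a i) - charFun (gaussianReal 0 v) t‖ ≤ η := by
  have hG2 : MemLp id 2 (gaussianReal 0 v) := memLp_id_gaussianReal 2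
  have hGv : ∫ y, y ^ 2 ∂(gaussianReal 0 v) = (v : ℝ) := by
    have h := variance_eq_integral (μ := gaussianReal 0 v) (X := id) aemeasurable_id
    rw [variance_id_gaussianReal] at h
    simpa using h.symm
  have hG0 : ∫ y, y ∂(gaussianReal 0 v) = 0 := integral_id_gaussianReal
  have hdiff := (charFun_sub_quadratic_isLittleO h2 h0 hv).sub
    (charFun_sub_quadratic_isLittleO hG2 hG0 hGv)
  have hη' : 0 < η / (t ^ 2 + 1) := by positivity
  obtain ⟨δ₀, hδ₀, hδ⟩ := Metric.eventually_nhds_iff.mp (hdiff.def hη')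
  -- This makes `|t a_i| < δ₀`, including when `t = 0`.
  refine ⟨δ₀ / (2 * (|t| + 1)), by positivity, fun n a ha hmax => ?_⟩
  -- Because `∑ a_i² = 1`, the Gaussian characteristic function factors along the same weights.
  have hgauss : charFun (gaussianReal 0 v) t = ∏ i, charFun (gaussianReal 0 v) (t * a i) := by
    simp_rw [charFun_gaussianReal]
    rw [← Complex.exp_sum]
    congr 1
    have ha' : ∑ i, (a i : ℂ) ^ 2 = 1 := by exact_mod_cast ha
    simp only [Complex.ofReal_zero, mul_zero, zero_mul, zero_sub, Complex.ofReal_mul, mul_pow]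
    rw [Finset.sum_neg_distrib, ← Finset.sum_div, ← Finset.mul_sum, ← Finset.mul_sum, ha', mul_one]
  rw [hgauss]
  refine (norm_prod_sub_prod_le _ _ _ (fun i _ => norm_charFun_le_one _)
    (fun i _ => norm_charFun_le_one _)).trans ?_
  calc ∑ i, ‖charFun μ (t * a i) - charFun (gaussianReal 0 v) (t * a i)‖
      ≤ ∑ i, η / (t ^ 2 + 1) * (t ^ 2 * a i ^ 2) := by
        refine Finset.sum_le_sum fun i _ => ?_
        have hsmall : dist (t * a i) 0 < δ₀ := by
          rw [dist_zero_right, Real.norm_eq_abs, abs_mul]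
          calc |t| * |a i| ≤ |t| * (δ₀ / (2 * (|t| + 1))) := by
                gcongr
                exact hmax i
            _ = δ₀ * (|t| / (2 * (|t| + 1))) := by ring
            _ < δ₀ * 1 := by
                gcongr
                rw [div_lt_one (by positivity)]
                linarith [abs_nonneg t]
            _ = δ₀ := mul_one _
        have h := hδ hsmall
        rw [sub_sub_sub_cancel_right, Real.norm_of_nonneg (sq_nonneg _), mul_pow] at h
        exact h
    _ = η * (t ^ 2 / (t ^ 2 + 1)) := by
        rw [← Finset.mul_sum, ← Finset.mul_sum, ha]
        ring
    _ ≤ η * 1 := by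
        gcongr
        rw [div_le_one (by positivity)]
        linarith
    _ = η := mul_one η

variable {Ω : Type*} [MeasurableSpace Ω] {P : Measure Ω} [IsProbabilityMeasure P]

/-- The characteristic function of a weighted sum of i.i.d. errors, the weights being a function of
a variable that is independent of the errors. -/
theorem charFun_weighted_sum {E : Type*} [MeasurableSpace E] {n : ℕ} {X : Ω → E}
    {e : Fin n → Ω → ℝ} (hX : Measurable X) (he : ∀ i, Measurable (e i)) (hindep : iIndepFun e P)
    {μ : Measure ℝ} [IsProbabilityMeasure μ] (hlaw : ∀ i, P.map (e i) = μ)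
    (hXe : IndepFun X (fun ω i => e i ω) P) {a : E → Fin n → ℝ} (ha : ∀ i, Measurable fun z => a z i)
    (t : ℝ) :
    charFun (P.map fun ω => ∑ i, a (X ω) i * e i ω) t =
      ∫ ω, ∏ i, charFun μ (t * a (X ω) i) ∂P := by
  have he' : Measurable fun ω i => e i ω := measurable_pi_iff.mpr he
  -- By independence the joint law is a product, so Fubini allows integrating out the errors with
  -- the weights frozen.
  have hjoint : P.map (fun ω => (X ω, fun i => e i ω)) =
      (P.map X).prod (Measure.pi fun _ => μ) := by
    rw [(indepFun_iff_map_prod_eq_prod_map_map hX.aemeasurable he'.aemeasurable).mp hXe,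
      (iIndepFun_iff_map_fun_eq_pi_map fun i => (he i).aemeasurable).mp hindep]
    simp_rw [hlaw]
  have : IsProbabilityMeasure (P.map X) := Measure.isProbabilityMeasure_map hX.aemeasurable
  have hsum : Measurable fun p : E × (Fin n → ℝ) => ∑ i, a p.1 i * p.2 i :=
    Finset.measurable_sum _ fun i _ =>
      ((ha i).comp measurable_fst).mul ((measurable_pi_apply i).comp measurable_snd)
  have hF : Measurable fun p : E × (Fin n → ℝ) =>
      Complex.exp (t * ((∑ i, a p.1 i * p.2 i : ℝ) : ℂ) * Complex.I) := by
    fun_prop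
  have hprod : Measurable fun z => ∏ i, charFun μ (t * a z i) :=
    Finset.measurable_prod _ fun i _ =>
      (stronglyMeasurable_charFun.measurable).comp ((ha i).const_mul t)
  have hpair : Measurable fun ω => (X ω, fun i => e i ω) := hX.prodMk he'
  calc charFun (P.map fun ω => ∑ i, a (X ω) i * e i ω) t
      = ∫ ω, Complex.exp (t * ((∑ i, a (X ω) i * e i ω : ℝ) : ℂ) * Complex.I) ∂P := by
        rw [charFun_apply_real, integral_map]
        · exact (hsum.comp hpair).aemeasurable
        · fun_prop
    _ = ∫ p, Complex.exp (t * ((∑ i, a p.1 i * p.2 i : ℝ) : ℂ) * Complex.I)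
          ∂((P.map X).prod (Measure.pi fun _ => μ)) := by
        rw [← hjoint, integral_map hpair.aemeasurable hF.aestronglyMeasurable]
    _ = ∫ z, ∫ y, Complex.exp (t * ((∑ i, a z i * y i : ℝ) : ℂ) * Complex.I)
          ∂(Measure.pi fun _ => μ) ∂(P.map X) := by
        refine integral_prod _ (Integrable.of_bound hF.aestronglyMeasurable 1 (.of_forall fun p => ?_))
        have := Complex.norm_exp_ofReal_mul_I (t * ∑ i, a p.1 i * p.2 i)
        rw [Complex.ofReal_mul] at this
        exact this.le
    _ = ∫ z, ∏ i, charFun μ (t * a z i) ∂(P.map X) := by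
        refine integral_congr_ae (.of_forall fun z => ?_)
        simp only
        simp_rw [charFun_apply_real]
        rw [← integral_fintype_prod_eq_prod]
        refine integral_congr_ae (.of_forall fun y => ?_)
        simp only
        rw [← Complex.exp_sum]
        congr 1
        push_cast
        rw [Finset.mul_sum, Finset.sum_mul]
        refine Finset.sum_congr rfl fun i _ => ?_
        ring
    _ = ∫ ω, ∏ i, charFun μ (t * a (X ω) i) ∂P :=
        integral_map hX.aemeasurable hprod.aestronglyMeasurable

/-- A central limit theorem for sums of i.i.d. errors with random weights that are independent of
the errors, and that are normalized and uniformly small with probability tending to one. -/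
theorem tendstoInDistribution_weighted_sum {E : ℕ → Type*} [∀ n, MeasurableSpace (E n)]
    {X : (n : ℕ) → Ω → E n} (hX : ∀ n, Measurable (X n))
    {e : ℕ → Ω → ℝ} (he : ∀ i, Measurable (e i)) (hindep : iIndepFun e P)
    (hident : ∀ i, IdentDistrib (e i) (e 0) P P) (h2 : MemLp (e 0) 2 P)
    (h0 : ∫ ω, e 0 ω ∂P = 0) {v : ℝ≥0} (hv : ∫ ω, e 0 ω ^ 2 ∂P = v)
    (hXe : ∀ n, IndepFun (X n) (fun ω (i : Fin n) => e i ω) P)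
    {a : (n : ℕ) → E n → Fin n → ℝ} (ha : ∀ n i, Measurable fun z => a n z i)
    (hsmall : ∀ δ > 0, Tendsto
      (fun n => P {ω | ¬ (∑ i, a n (X n ω) i ^ 2 = 1 ∧ ∀ i, |a n (X n ω) i| ≤ δ)}) atTop (𝓝 0)) :
    TendstoInDistribution (fun n ω => ∑ i : Fin n, a n (X n ω) i * e i ω) atTop (id : ℝ → ℝ)
      (fun _ => P) (gaussianReal 0 v) where
  forall_aemeasurable n := by
    refine (Finset.measurable_sum _ fun i _ => ?_).aemeasurable
    exact ((ha n i).comp (hX n)).mul (he i)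
  aemeasurable_limit := aemeasurable_id
  tendsto := by
    refine ProbabilityMeasure.tendsto_iff_tendsto_charFun.2 fun t => ?_
    simp only [ProbabilityMeasure.coe_mk, Measure.map_id]
    set μ := P.map (e 0) with hμ
    have : IsProbabilityMeasure μ := Measure.isProbabilityMeasure_map (he 0).aemeasurable
    have hcf : ∀ n, charFun (P.map fun ω => ∑ i : Fin n, a n (X n ω) i * e i ω) t =
        ∫ ω, ∏ i, charFun μ (t * a n (X n ω) i) ∂P := fun n =>
      charFun_weighted_sum (hX n) (fun i => he i) (hindep.precomp Fin.val_injective)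
        (fun i => (hident i).map_eq) (hXe n) (ha n) t
    simp_rw [hcf]
    have hμ2 : MemLp id 2 μ := (memLp_map_measure_iff aestronglyMeasurable_id
      (he 0).aemeasurable).mpr h2
    have hμ0 : ∫ y, y ∂μ = 0 := by
      rw [hμ, integral_map (he 0).aemeasurable (by fun_prop), h0]
    have hμv : ∫ y, y ^ 2 ∂μ = v := by
      rw [hμ, integral_map (he 0).aemeasurable (by fun_prop), hv]
    rw [Metric.tendsto_atTop']
    intro η hη
    obtain ⟨δ, hδ, hclose⟩ := prod_charFun_close_gaussian hμ2 hμ0 hμv t (half_pos hη)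
    have hreal := (ENNReal.tendsto_toReal ENNReal.zero_ne_top).comp (hsmall δ hδ)
    obtain ⟨N, hN⟩ := eventually_atTop.mp
      (hreal.eventually (gt_mem_nhds (show (0 : ℝ≥0∞).toReal < η / 4 by simpa using by positivity)))
    refine ⟨N, fun n hn => ?_⟩
    set bad := {ω | ¬ (∑ i, a n (X n ω) i ^ 2 = 1 ∧ ∀ i, |a n (X n ω) i| ≤ δ)} with hbad
    have hai : ∀ i, Measurable fun ω => a n (X n ω) i := fun i => (ha n i).comp (hX n)
    have hbadm : MeasurableSet bad := by
      refine MeasurableSet.compl (MeasurableSet.inter ?_ ?_)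
      · exact measurableSet_eq_fun (Finset.measurable_sum _ fun i _ => (hai i).pow_const 2)
          measurable_const
      · have hall : {ω | ∀ i, |a n (X n ω) i| ≤ δ} = ⋂ i, {ω | |a n (X n ω) i| ≤ δ} := by
          ext ω
          simp
        change MeasurableSet {ω | ∀ i, |a n (X n ω) i| ≤ δ}
        rw [hall]
        exact MeasurableSet.iInter fun i => measurableSet_le (hai i).abs measurable_const
    have hprodm : Measurable fun ω => ∏ i, charFun μ (t * a n (X n ω) i) :=
      Finset.measurable_prod _ fun i _ =>
        (stronglyMeasurable_charFun.measurable).comp ((hai i).const_mul t)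
    have hprod1 : ∀ ω, ‖∏ i, charFun μ (t * a n (X n ω) i)‖ ≤ 1 := fun ω => by
      rw [norm_prod]
      exact Finset.prod_le_one (fun _ _ => norm_nonneg _) fun i _ => norm_charFun_le_one _
    have hint : Integrable (fun ω => ∏ i, charFun μ (t * a n (X n ω) i)) P :=
      Integrable.of_bound hprodm.aestronglyMeasurable 1 (.of_forall hprod1)
    have hsub : ∫ ω, ∏ i, charFun μ (t * a n (X n ω) i) ∂P - charFun (gaussianReal 0 v) t =
        ∫ ω, (∏ i, charFun μ (t * a n (X n ω) i) - charFun (gaussianReal 0 v) t) ∂P := by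
      rw [integral_sub hint (integrable_const _)]
      simp
    rw [dist_eq_norm, hsub]
    -- Off the bad event the weights satisfy the conditions of `hclose`; on it, two numbers in the
    -- unit disc differ by at most 2.
    have hbound : ∀ ω, ‖∏ i, charFun μ (t * a n (X n ω) i) - charFun (gaussianReal 0 v) t‖ ≤
        η / 2 + bad.indicator (fun _ => (2 : ℝ)) ω := by
      intro ω
      by_cases hω : ω ∈ bad
      · rw [Set.indicator_of_mem hω]
        refine (norm_sub_le _ _).trans ?_
        have := norm_charFun_le_one (μ := gaussianReal 0 v) t
        linarith [hprod1 ω]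
      · rw [Set.indicator_of_notMem hω, add_zero]
        have hω' := not_not.mp hω
        exact hclose n _ hω'.1 hω'.2
    have hgint : Integrable (fun ω => η / 2 + bad.indicator (fun _ => (2 : ℝ)) ω) P :=
      (integrable_const _).add ((integrable_const _).indicator hbadm)
    calc _ ≤ ∫ ω, (η / 2 + bad.indicator (fun _ => (2 : ℝ)) ω) ∂P :=
          norm_integral_le_of_norm_le hgint (.of_forall hbound)
      _ = η / 2 + 2 * P.real bad := by
          rw [integral_add (integrable_const _) ((integrable_const _).indicator hbadm),
            integral_indicator_const _ hbadm]
          simp [mul_comm]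
      _ < η := by
          have : P.real bad < η / 4 := hN n hn.le
          linarith

end WeightedCLT

/-! ### Measurability of the weights in the covariates. -/

section Measurability

variable {d n : ℕ}

theorem IsHyperrectangle.measurableSet {A : Set (EuclideanSpace ℝ (Fin d))}
    (hA : IsHyperrectangle A) : MeasurableSet A := by
  obtain ⟨I, hI, rfl⟩ := hA
  have : {z : EuclideanSpace ℝ (Fin d) | ∀ j, z j ∈ I j} = ⋂ j, (fun z => z j) ⁻¹' I j := by
    ext z
    simp
  rw [this]
  exact MeasurableSet.iInter fun j => (hI j).measurableSet.preimage (by fun_prop)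

/-- The evaluation point may depend on the covariates: a constant `ζ` serves `k_n`, and a coordinate
projection serves the rows of `K_n`. -/
theorem measurable_structureVector (D : TreeDraw d n)
    {ζ : (Fin n → EuclideanSpace ℝ (Fin d)) → EuclideanSpace ℝ (Fin d)} (hζ : Measurable ζ)
    (k : Fin n) : Measurable fun xs => structureVector D xs (ζ xs) k := by
  classical
  unfold structureVector
  refine Finset.measurable_sum _ fun A hA => ?_
  have hAm : MeasurableSet A := (D.tree.rectangle A hA).measurableSet
  have hset : ∀ i, MeasurableSet {xs : Fin n → EuclideanSpace ℝ (Fin d) |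
      xs i ∈ A ∧ i ∈ D.subsample} := fun i =>
    (hAm.preimage (measurable_pi_apply i)).inter (MeasurableSet.const _)
  refine Measurable.ite (hAm.preimage hζ) ?_ measurable_const
  exact (Measurable.ite (hset k) measurable_const measurable_const).div
    (Finset.measurable_sum _ fun i _ => Measurable.ite (hset i) measurable_const measurable_const)

namespace TreeScheme

variable (S : TreeScheme d)

theorem measurable_kVec {ζ : (Fin n → EuclideanSpace ℝ (Fin d)) → EuclideanSpace ℝ (Fin d)}
    (hζ : Measurable ζ) (k : Fin n) : Measurable fun xs => S.kVec n xs (ζ xs) k := by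
  simp_rw [kVec_eq_sum]
  refine Finset.measurable_sum _ fun q _ => (S.measurable_law n q).ennreal_toReal.mul ?_
  unfold subsampleMean
  exact Finset.measurable_sum _ fun w _ => (measurable_structureVector ⟨q, w⟩ hζ k).const_mul _

theorem measurable_rVec (lam : ℝ) (z : EuclideanSpace ℝ (Fin d)) (j : Fin n) :
    Measurable fun xs => S.rVec lam n xs z j := by
  have hdet : Measurable fun M : Fin n → Fin n → ℝ => (Matrix.of M).det := by
    refine Continuous.measurable ?_
    exact Continuous.matrix_det (A := fun M : Fin n → Fin n → ℝ => Matrix.of M) continuous_id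
  have hadj : ∀ i, Measurable fun M : Fin n → Fin n → ℝ => (Matrix.of M).adjugate i j := by
    intro i
    refine Continuous.measurable ?_
    exact (Continuous.matrix_adjugate (A := fun M : Fin n → Fin n → ℝ => Matrix.of M)
      continuous_id).matrix_elem i j
  have hM : Measurable fun (xs : Fin n → EuclideanSpace ℝ (Fin d)) (a b : Fin n) =>
      ((1 / lam) • (1 : Matrix (Fin n) (Fin n) ℝ) + S.kMat n xs) a b := by
    refine measurable_pi_iff.mpr fun a => measurable_pi_iff.mpr fun b => ?_
    simp only [Matrix.add_apply, kMat_apply]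
    exact (S.measurable_kVec (measurable_pi_apply a) b).const_add _
  -- Writing the inverse as adjugate over determinant reduces measurability to functions continuous
  -- in the matrix entries.
  have hform : ∀ xs, S.rVec lam n xs z j = ∑ i, S.kVec n xs z i *
      ((Matrix.of fun a b =>
          ((1 / lam) • (1 : Matrix (Fin n) (Fin n) ℝ) + S.kMat n xs) a b).det⁻¹ *
        (Matrix.of fun a b =>
          ((1 / lam) • (1 : Matrix (Fin n) (Fin n) ℝ) + S.kMat n xs) a b).adjugate i j) := by
    intro xs
    unfold rVec
    simp only [Matrix.vecMul, dotProduct, Matrix.inv_def, Ring.inverse_eq_inv', Matrix.smul_apply,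
      smul_eq_mul]
    rfl
  simp_rw [hform]
  refine Finset.measurable_sum _ fun i _ => (S.measurable_kVec measurable_const i).mul ?_
  exact ((hdet.comp hM).inv).mul ((hadj i).comp hM)

end TreeScheme

end Measurability

/-! ### Subsamples meeting a leaf, and the deterministic bound on the entries of `r_n` relative to
its norm. -/

section HittingProbability

variable {d n : ℕ}

/-- Division-free form of the fact that `m` draws without replacement all land in a set of
proportion `a/n` with probability at most `(a/n)^m`: each factor `(a-j)/(n-j)` is at most `a/n`. -/
theorem descFactorial_mul_pow_le {a n : ℕ} (h : a ≤ n) (m : ℕ) :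
    a.descFactorial m * n ^ m ≤ n.descFactorial m * a ^ m := by
  induction m with
  | zero => simp
  | succ m ih =>
    have h1 : (a - m) * n ≤ (n - m) * a := by
      rw [Nat.sub_mul, Nat.sub_mul]
      have := Nat.mul_le_mul_left m h
      rw [mul_comm n a]
      omega
    calc a.descFactorial (m + 1) * n ^ (m + 1)
        = ((a - m) * n) * (a.descFactorial m * n ^ m) := by
          rw [Nat.descFactorial_succ, pow_succ]
          ring
      _ ≤ ((n - m) * a) * (n.descFactorial m * a ^ m) := Nat.mul_le_mul h1 ih
      _ = n.descFactorial (m + 1) * a ^ (m + 1) := by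
          rw [Nat.descFactorial_succ, pow_succ]
          ring

theorem choose_mul_pow_le {a n : ℕ} (h : a ≤ n) (m : ℕ) :
    a.choose m * n ^ m ≤ n.choose m * a ^ m := by
  have := descFactorial_mul_pow_le h m
  rw [Nat.descFactorial_eq_factorial_mul_choose, Nat.descFactorial_eq_factorial_mul_choose,
    mul_assoc, mul_assoc] at this
  exact Nat.le_of_mul_le_mul_left this m.factorial_pos

theorem uniformSubsample_toReal (m : ℕ) (h : m ≤ n) (w : Finset (Fin n)) :
    (uniformSubsample n m h w).toReal = if w.card = m then ((n.choose m : ℕ) : ℝ)⁻¹ else 0 := by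
  unfold uniformSubsample
  rw [PMF.uniformOfFinset_apply]
  by_cases hw : w.card = m <;> simp [Finset.mem_powersetCard, hw]

/-- A uniform subsample of size `m` misses a given set of `N` indices with probability at most
`exp (- m N / n)`. -/
theorem sum_uniformSubsample_disjoint_le (m : ℕ) (h : m ≤ n) (I : Finset (Fin n)) :
    ∑ w, (uniformSubsample n m h w).toReal * (if Disjoint w I then 1 else 0) ≤
      Real.exp (-((m : ℝ) * I.card / n)) := by
  have hsum : ∑ w, (uniformSubsample n m h w).toReal * (if Disjoint w I then 1 else 0) =
      ((n - I.card).choose m : ℕ) * ((n.choose m : ℕ) : ℝ)⁻¹ := by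
    have hfil : Finset.univ.filter (fun w : Finset (Fin n) => Disjoint w I ∧ w.card = m) =
        Finset.powersetCard m Iᶜ := by
      ext w
      simp [Finset.mem_powersetCard, Finset.subset_compl_iff_disjoint_right]
    have hterm : ∀ w : Finset (Fin n),
        (uniformSubsample n m h w).toReal * (if Disjoint w I then (1 : ℝ) else 0) =
        if Disjoint w I ∧ w.card = m then ((n.choose m : ℕ) : ℝ)⁻¹ else 0 := by
      intro w
      rw [uniformSubsample_toReal]
      by_cases h1 : Disjoint w I <;> by_cases h2 : w.card = m <;> simp [h1, h2]
    simp_rw [hterm]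
    rw [← Finset.sum_filter, hfil, Finset.sum_const, Finset.card_powersetCard, Finset.card_compl,
      Fintype.card_fin, nsmul_eq_mul]
  rw [hsum]
  rcases Nat.eq_zero_or_pos n with rfl | hn
  · obtain rfl : m = 0 := by omega
    simp
  have hI : I.card ≤ n := by simpa using I.card_le_univ
  have hchoose : (0 : ℝ) < (n.choose m : ℕ) := by exact_mod_cast Nat.choose_pos h
  have hn' : (0 : ℝ) < n := by exact_mod_cast hn
  have h1 := choose_mul_pow_le (Nat.sub_le n I.card) m
  have h2 : (((n - I.card).choose m : ℕ) : ℝ) * (n : ℝ) ^ m ≤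
      (n.choose m : ℕ) * ((n : ℝ) - I.card) ^ m := by
    have : ((n - I.card : ℕ) : ℝ) = (n : ℝ) - I.card := Nat.cast_sub hI
    rw [← this]
    exact_mod_cast h1
  calc ((n - I.card).choose m : ℕ) * ((n.choose m : ℕ) : ℝ)⁻¹
      ≤ (((n : ℝ) - I.card) / n) ^ m := by
        rw [← div_eq_mul_inv, div_pow, div_le_div_iff₀ hchoose (by positivity)]
        linarith
    _ ≤ (Real.exp (-((I.card : ℝ) / n))) ^ m := by
        have hI' : (I.card : ℝ) ≤ n := by exact_mod_cast hI
        refine pow_le_pow_left₀ (div_nonneg (by linarith) hn'.le) ?_ m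
        have := Real.add_one_le_exp (-((I.card : ℝ) / n))
        rw [sub_div, div_self hn'.ne']
        linarith
    _ = Real.exp (-((m : ℝ) * I.card / n)) := by
        rw [← Real.exp_nat_mul]
        congr 1
        ring

/-- The number of sample points in `A`. -/
noncomputable def sampleCount (A : Set (EuclideanSpace ℝ (Fin d)))
    (xs : Fin n → EuclideanSpace ℝ (Fin d)) : ℝ :=
  ∑ i, A.indicator (1 : EuclideanSpace ℝ (Fin d) → ℝ) (xs i)

theorem sum_subsampleMean_ge (m : ℕ) (h : m ≤ n) (q : TreeStructure d)
    {A : Set (EuclideanSpace ℝ (Fin d))} (hA : A ∈ q.leaves)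
    (xs : Fin n → EuclideanSpace ℝ (Fin d)) {z : EuclideanSpace ℝ (Fin d)} (hz : z ∈ A) :
    1 - Real.exp (-((m : ℝ) * sampleCount A xs / n)) ≤ ∑ k, subsampleMean m h q xs z k := by
  classical
  set I : Finset (Fin n) := Finset.univ.filter fun i => xs i ∈ A with hI
  have hcard : sampleCount A xs = I.card := by
    simp [sampleCount, hI, Set.indicator_apply]
  rw [hcard]
  have hdis := sum_uniformSubsample_disjoint_le m h I
  -- The weights of a draw sum to one exactly when the subsample meets the leaf, so the total mean
  -- weight is a hitting probability.
  have hsum : ∑ k, subsampleMean m h q xs z k =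
      1 - ∑ w, (uniformSubsample n m h w).toReal * (if Disjoint w I then 1 else 0) := by
    rw [eq_sub_iff_add_eq]
    refine Eq.trans ?_ (sum_uniformSubsample m h)
    unfold subsampleMean
    rw [Finset.sum_comm, ← Finset.sum_add_distrib]
    refine Finset.sum_congr rfl fun w _ => ?_
    rw [← Finset.mul_sum, sum_structureVector_of_mem (D := ⟨q, w⟩) hA hz]
    have : (∃ i ∈ w, xs i ∈ A) ↔ ¬ Disjoint w I := by
      rw [Finset.not_disjoint_iff]
      simp [hI]
    by_cases hd : Disjoint w I
    · rw [if_neg (by rw [this]; exact not_not.mpr hd), if_pos hd]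
      ring
    · rw [if_pos (this.mpr hd), if_neg hd]
      ring
  rw [hsum]
  linarith

theorem subsampleMean_of_not_mem (m : ℕ) (h : m ≤ n) (q : TreeStructure d)
    {A : Set (EuclideanSpace ℝ (Fin d))} (hA : A ∈ q.leaves)
    (xs : Fin n → EuclideanSpace ℝ (Fin d)) {z : EuclideanSpace ℝ (Fin d)} (hz : z ∈ A)
    {k : Fin n} (hk : xs k ∉ A) : subsampleMean m h q xs z k = 0 := by
  unfold subsampleMean
  refine Finset.sum_eq_zero fun w _ => ?_
  rw [structureVector_of_mem (D := ⟨q, w⟩) hA hz]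
  simp [hk]

/-- The mean weight of a sample point is at most one over the number of points in the leaf. -/
theorem sampleCount_mul_subsampleMean_le_one (m : ℕ) (h : m ≤ n) (q : TreeStructure d)
    {A : Set (EuclideanSpace ℝ (Fin d))} (hA : A ∈ q.leaves)
    (xs : Fin n → EuclideanSpace ℝ (Fin d)) {z : EuclideanSpace ℝ (Fin d)} (hz : z ∈ A)
    -- All sample points of the leaf share the same mean weight, and together these weights sum to
    -- at most one.
    (k : Fin n) : sampleCount A xs * subsampleMean m h q xs z k ≤ 1 := by
  by_cases hk : xs k ∈ A
  · refine le_trans ?_ (sum_subsampleMean_le_one m h q xs z)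
    rw [sampleCount, Finset.sum_mul]
    refine Finset.sum_le_sum fun i _ => ?_
    by_cases hi : xs i ∈ A
    · rw [Set.indicator_of_mem hi, Pi.one_apply, one_mul]
      refine le_of_eq (subsampleMean_eq_of_same_leaf m h q z fun B hB => ?_)
      rcases eq_or_ne A B with rfl | hne
      · simp [hi, hk]
      · have hd := Set.disjoint_left.mp (q.disjoint A hA B hB hne)
        simp [hd hi, hd hk]
    · rw [Set.indicator_of_notMem hi, zero_mul]
      exact subsampleMean_nonneg m h q xs z i
  · simp [subsampleMean_of_not_mem m h q hA xs hz hk]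

theorem TreeStructure.exists_leaf (q : TreeStructure d) {x : EuclideanSpace ℝ (Fin d)}
    (hx : x ∈ unitCube d) : ∃ A ∈ q.leaves, x ∈ A := by
  rw [← q.cover] at hx
  simpa using hx

/-- When every leaf at `x` holds many sample points, all of which lie in a set that is not too
crowded, the entries of `r_n` are small relative to its norm. -/
theorem TreeScheme.sq_rVec_le (S : TreeScheme d) {lam : ℝ} (hlam0 : 0 < lam) (hlam1 : lam < 1)
    (xs : Fin n → EuclideanSpace ℝ (Fin d)) {x : EuclideanSpace ℝ (Fin d)} (hx : x ∈ unitCube d)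
    {U : Set (EuclideanSpace ℝ (Fin d))} {N₀ M₀ : ℝ} (hN₀ : 0 < N₀) (hM₀ : 0 < M₀)
    (hleafU : ∀ q ∈ S.Q n, ∀ A ∈ q.leaves, x ∈ A → A ⊆ U)
    (hcount : ∀ q ∈ S.Q n, ∀ A ∈ q.leaves, x ∈ A → N₀ ≤ sampleCount A xs)
    (hU : sampleCount U xs ≤ M₀) (hm : Real.exp (-((S.m n : ℝ) * N₀ / n)) ≤ 1 / 2) :
    0 < ∑ j, S.rVec lam n xs x j ^ 2 ∧ ∀ i, S.rVec lam n xs x i ^ 2 ≤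
      (lam / (1 - lam)) ^ 2 * (8 * ((1 / lam) ^ 2 + 1)) * (M₀ / N₀ ^ 2) *
        ∑ j, S.rVec lam n xs x j ^ 2 := by
  have hlaw0 : ∀ q, 0 ≤ (S.law n xs q).toReal := fun q => ENNReal.toReal_nonneg
  have hk_le : ∀ i, S.kVec n xs x i ≤ 1 / N₀ := by
    intro i
    have hconst : ∑ q ∈ S.Q n, (S.law n xs q).toReal * (1 / N₀) = 1 / N₀ := by
      rw [← Finset.sum_mul, S.sum_law xs, one_mul]
    rw [S.kVec_eq_sum, ← hconst]
    refine Finset.sum_le_sum fun q hq => mul_le_mul_of_nonneg_left ?_ (hlaw0 q)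
    obtain ⟨A, hA, hxA⟩ := q.exists_leaf hx
    have h1 := sampleCount_mul_subsampleMean_le_one (S.m n) (S.m_le n) q hA xs hxA i
    have h2 := subsampleMean_nonneg (S.m n) (S.m_le n) q xs x i
    rw [le_div_iff₀ hN₀, mul_comm]
    exact (mul_le_mul_of_nonneg_right (hcount q hq A hA hxA) h2).trans h1
  have hk_sum : 1 / 2 ≤ ∑ i, S.kVec n xs x i := by
    have hconst : ∑ q ∈ S.Q n, (S.law n xs q).toReal * (1 / 2) = 1 / 2 := by
      rw [← Finset.sum_mul, S.sum_law xs, one_mul]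
    simp_rw [S.kVec_eq_sum]
    rw [Finset.sum_comm, ← hconst]
    refine Finset.sum_le_sum fun q hq => ?_
    rw [← Finset.mul_sum]
    refine mul_le_mul_of_nonneg_left ?_ (hlaw0 q)
    obtain ⟨A, hA, hxA⟩ := q.exists_leaf hx
    refine le_trans ?_ (sum_subsampleMean_ge (S.m n) (S.m_le n) q hA xs hxA)
    have : Real.exp (-((S.m n : ℝ) * sampleCount A xs / n)) ≤
        Real.exp (-((S.m n : ℝ) * N₀ / n)) := by
      gcongr
      exact hcount q hq A hA hxA
    linarith
  have hk_supp : ∀ i, S.kVec n xs x i =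
      S.kVec n xs x i * U.indicator (1 : EuclideanSpace ℝ (Fin d) → ℝ) (xs i) := by
    intro i
    by_cases hi : xs i ∈ U
    · simp [hi]
    · rw [Set.indicator_of_notMem hi, mul_zero, S.kVec_eq_sum]
      refine Finset.sum_eq_zero fun q hq => ?_
      obtain ⟨A, hA, hxA⟩ := q.exists_leaf hx
      rw [subsampleMean_of_not_mem (S.m n) (S.m_le n) q hA xs hxA
        fun h => hi (hleafU q hq A hA hxA h), mul_zero]
  -- Cauchy–Schwarz against the indicator of `U`: total mass at least 1/2, carried by at most `M₀`
  -- sample points, cannot have a small Euclidean norm.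
  have hk_sq : 1 / 4 ≤ M₀ * ∑ j, S.kVec n xs x j ^ 2 := by
    have hcs := Finset.sum_mul_sq_le_sq_mul_sq Finset.univ (fun i => S.kVec n xs x i)
      (fun i => U.indicator (1 : EuclideanSpace ℝ (Fin d) → ℝ) (xs i))
    simp_rw [← hk_supp] at hcs
    have hind : ∑ i, U.indicator (1 : EuclideanSpace ℝ (Fin d) → ℝ) (xs i) ^ 2 =
        sampleCount U xs := by
      refine Finset.sum_congr rfl fun i _ => ?_
      by_cases hi : xs i ∈ U <;> simp [hi]
    rw [hind] at hcs
    have h1 : (1 / 2 : ℝ) ^ 2 ≤ (∑ i, S.kVec n xs x i) ^ 2 :=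
      pow_le_pow_left₀ (by norm_num) hk_sum 2
    have h2 : (0 : ℝ) ≤ ∑ j, S.kVec n xs x j ^ 2 := Finset.sum_nonneg fun _ _ => sq_nonneg _
    nlinarith [mul_le_mul_of_nonneg_left hU h2]
  set R := ∑ j, S.rVec lam n xs x j ^ 2 with hR
  have hkr := S.sum_sq_kVec_le hlam0 hlam1 xs x
  rw [← hR] at hkr
  have hC : 0 < 2 * ((1 / lam) ^ 2 + 1) := by positivity
  have hbig : 1 ≤ 8 * ((1 / lam) ^ 2 + 1) * M₀ * R := by
    have := mul_le_mul_of_nonneg_left hkr hM₀.le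
    nlinarith
  refine ⟨?_, fun i => ?_⟩
  · by_contra hneg
    push Not at hneg
    have : 8 * ((1 / lam) ^ 2 + 1) * M₀ * R ≤ 0 :=
      mul_nonpos_of_nonneg_of_nonpos (by positivity) hneg
    linarith
  · have h1 := S.abs_rVec_le hlam0 hlam1 xs x hk_le i
    have h2 : S.rVec lam n xs x i ^ 2 ≤ (lam / (1 - lam) * (1 / N₀)) ^ 2 := by
      rw [← sq_abs]
      exact pow_le_pow_left₀ (abs_nonneg _) h1 2
    refine h2.trans ?_
    have h3 : 0 ≤ (lam / (1 - lam) * (1 / N₀)) ^ 2 := sq_nonneg _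
    calc (lam / (1 - lam) * (1 / N₀)) ^ 2
        ≤ (lam / (1 - lam) * (1 / N₀)) ^ 2 * (8 * ((1 / lam) ^ 2 + 1) * M₀ * R) :=
          le_mul_of_one_le_right h3 hbig
      _ = _ := by ring

end HittingProbability

/-! ### Tail bounds for the number of sample points in a set. -/

section Counting

variable {d : ℕ} {Ω : Type*} [MeasurableSpace Ω] {P : Measure Ω} [IsProbabilityMeasure P]
  {X : ℕ → Ω → EuclideanSpace ℝ (Fin d)}

/-- Lower tail of the number of sample points in a set. -/
theorem measure_sampleCount_le (hX : ∀ i, Measurable (X i)) (hindep : iIndepFun X P)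
    {A : Set (EuclideanSpace ℝ (Fin d))} (hA : MeasurableSet A) {p : ℝ}
    (hp : ∀ i, p ≤ P.real (X i ⁻¹' A)) (n : ℕ) :
    P.real {ω | sampleCount A (fun i : Fin n => X i ω) ≤ n * p / 2} ≤
      Real.exp (-(n * p / 8)) := by
  have hp0 : p ≤ 1 := (hp 0).trans measureReal_le_one
  set I : Fin n → Ω → ℝ := fun i ω =>
    A.indicator (1 : EuclideanSpace ℝ (Fin d) → ℝ) (X i ω) with hI
  have hindm : Measurable (A.indicator (1 : EuclideanSpace ℝ (Fin d) → ℝ)) :=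
    measurable_one.indicator hA
  have hIm : ∀ i, Measurable (I i) := fun i => hindm.comp (hX i)
  have hIindep : iIndepFun I P :=
    (hindep.precomp (g := fun i : Fin n => (i : ℕ)) Fin.val_injective).comp
      (fun _ => A.indicator (1 : EuclideanSpace ℝ (Fin d) → ℝ)) fun _ => hindm
  have hsumeq : ∀ ω, sampleCount A (fun i : Fin n => X i ω) = (∑ i, I i) ω := by
    intro ω
    simp [sampleCount, hI, Finset.sum_apply]
  have hInn : ∀ ω, 0 ≤ (∑ i, I i) ω := by
    intro ω
    rw [Finset.sum_apply]
    exact Finset.sum_nonneg fun i _ => Set.indicator_nonneg (fun _ _ => zero_le_one) _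
  have hSm : Measurable (∑ i, I i) := by
    convert Finset.measurable_sum Finset.univ fun i _ => hIm i using 1
    ext ω
    simp
  have hint : Integrable (fun ω => Real.exp (-1 * (∑ i, I i) ω)) P := by
    refine Integrable.of_bound (by fun_prop) 1 (.of_forall fun ω => ?_)
    rw [Real.norm_of_nonneg (Real.exp_pos _).le, Real.exp_le_one_iff]
    have := hInn ω
    linarith
  have htail := measure_le_le_exp_mul_mgf (μ := P) (X := ∑ i, I i) (t := -1) (n * p / 2)
    (by norm_num) hint
  -- The Chernoff bound is taken at parameter `-1`. From `1 - e⁻¹ ≥ 5/8`, the exponent becomes `1/2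
  -- - 5/8 = -1/8` times `n p`.
  have he : Real.exp (-1) ≤ 3 / 8 := by
    rw [Real.exp_neg, inv_le_comm₀ (Real.exp_pos 1) (by norm_num)]
    have := Real.exp_one_gt_d9
    norm_num at this ⊢
    linarith
  have hmgf : ∀ i, mgf (I i) P (-1) ≤ Real.exp (-(5 / 8 * p)) := by
    intro i
    have hsetm : MeasurableSet (X i ⁻¹' A) := hA.preimage (hX i)
    have hfun : ∀ ω, Real.exp (-1 * I i ω) =
        1 - (X i ⁻¹' A).indicator (fun _ => 1 - Real.exp (-1)) ω := by
      intro ω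
      by_cases hω : X i ω ∈ A
      · have hω' : ω ∈ X (i : ℕ) ⁻¹' A := hω
        rw [Set.indicator_of_mem hω']
        simp [hI, hω]
      · have hω' : ω ∉ X (i : ℕ) ⁻¹' A := hω
        rw [Set.indicator_of_notMem hω']
        simp [hI, hω]
    have hval : mgf (I i) P (-1) = 1 - P.real (X i ⁻¹' A) * (1 - Real.exp (-1)) := by
      unfold mgf
      simp_rw [hfun]
      rw [integral_sub (integrable_const _) ((integrable_const _).indicator hsetm),
        integral_indicator_const _ hsetm]
      simp
    rw [hval]
    refine le_trans ?_ (Real.one_sub_le_exp_neg _)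
    have h1 := hp i
    have h2 : (0 : ℝ) ≤ P.real (X i ⁻¹' A) := measureReal_nonneg
    nlinarith
  have hprod : mgf (∑ i, I i) P (-1) ≤ Real.exp (-(5 / 8 * p)) ^ n := by
    rw [hIindep.mgf_sum hIm]
    refine (Finset.prod_le_prod (fun i _ => mgf_nonneg) fun i _ => hmgf i).trans ?_
    simp
  simp_rw [hsumeq]
  refine htail.trans ?_
  calc Real.exp (-(-1) * (n * p / 2)) * mgf (∑ i, I i) P (-1)
      ≤ Real.exp (-(-1) * (n * p / 2)) * Real.exp (-(5 / 8 * p)) ^ n := by gcongr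
    _ = Real.exp (-(n * p / 8)) := by
        rw [← Real.exp_nat_mul, ← Real.exp_add]
        congr 1
        ring

/-- Markov's inequality for the number of sample points in a set. -/
theorem measure_lt_sampleCount_le (hX : ∀ i, Measurable (X i))
    {U : Set (EuclideanSpace ℝ (Fin d))} (hU : MeasurableSet U) {p : ℝ}
    (hp : ∀ i, P.real (X i ⁻¹' U) ≤ p) (n : ℕ) {M : ℝ} (hM : 0 < M) :
    P.real {ω | M < sampleCount U (fun i : Fin n => X i ω)} ≤ n * p / M := by
  have hsetm : ∀ i, MeasurableSet (X i ⁻¹' U) := fun i => hU.preimage (hX i)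
  have hfun : ∀ ω, sampleCount U (fun i : Fin n => X i ω) =
      ∑ i : Fin n, (X i ⁻¹' U).indicator (fun _ => (1 : ℝ)) ω := fun ω => rfl
  have hint : ∀ i : Fin n, Integrable ((X i ⁻¹' U).indicator fun _ => (1 : ℝ)) P :=
    fun i => (integrable_const _).indicator (hsetm i)
  have hmarkov := mul_meas_ge_le_integral_of_nonneg (μ := P)
    (f := fun ω => sampleCount U (fun i : Fin n => X i ω))
    (.of_forall fun ω => Finset.sum_nonneg fun i _ =>
      Set.indicator_nonneg (fun _ _ => zero_le_one) _)
    (by simp_rw [hfun]; exact integrable_finsetSum _ fun i _ => hint i) M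
  have hmean : ∫ ω, sampleCount U (fun i : Fin n => X i ω) ∂P ≤ n * p := by
    simp_rw [hfun]
    rw [integral_finsetSum _ fun i _ => hint i]
    refine (Finset.sum_le_sum (g := fun _ => p) fun i _ => ?_).trans (by simp)
    rw [integral_indicator_const _ (hsetm i)]
    simpa using hp i
  rw [le_div_iff₀ hM, mul_comm]
  refine le_trans (mul_le_mul_of_nonneg_left ?_ hM.le) (hmarkov.trans hmean)
  exact measureReal_mono fun ω (hω : M < _) => hω.le

end Counting

/-! ### Geometry of the leaves, and comparison of the covariate law with volume. -/

section Geometry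

variable {d : ℕ}

theorem isBounded_unitCube : Bornology.IsBounded (unitCube d) := by
  refine (Metric.isBounded_closedBall (x := 0) (r := Real.sqrt d)).subset fun z hz => ?_
  rw [mem_closedBall_zero_iff, EuclideanSpace.norm_eq]
  refine Real.sqrt_le_sqrt ?_
  calc ∑ i, ‖z i‖ ^ 2 ≤ ∑ _ : Fin d, (1 : ℝ) := by
        refine Finset.sum_le_sum fun i _ => ?_
        rw [Real.norm_of_nonneg (hz i).1]
        exact pow_le_one₀ (hz i).1 (hz i).2
    _ = d := by simp

theorem TreeStructure.leaf_subset_unitCube (q : TreeStructure d)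
    {A : Set (EuclideanSpace ℝ (Fin d))} (hA : A ∈ q.leaves) : A ⊆ unitCube d := by
  rw [← q.cover]
  exact Set.subset_biUnion_of_mem (u := fun A => A) hA

/-- `Metric.diam` is `0` on unbounded sets, so the diameter bound is informative only because leaves
lie in the bounded cube. -/
theorem TreeStructure.leaf_subset_closedBall (q : TreeStructure d)
    {A : Set (EuclideanSpace ℝ (Fin d))} (hA : A ∈ q.leaves) {x : EuclideanSpace ℝ (Fin d)}
    (hx : x ∈ A) {R : ℝ} (hR : Metric.diam A ≤ R) : A ⊆ Metric.closedBall x R := fun z hz =>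
  Metric.mem_closedBall.mpr ((Metric.dist_le_diam_of_mem
    (isBounded_unitCube.subset (q.leaf_subset_unitCube hA)) hz hx).trans hR)

theorem measurableSet_unitCube : MeasurableSet (unitCube d) := by
  refine IsHyperrectangle.measurableSet ⟨fun _ => Set.Icc 0 1, fun _ => Set.ordConnected_Icc, rfl⟩

variable {Ω : Type*} [MeasurableSpace Ω] {P : Measure Ω}
  {Z : Ω → EuclideanSpace ℝ (Fin d)} {dens : EuclideanSpace ℝ (Fin d) → ℝ} {c₁ c₂ : ℝ}

theorem measure_preimage_eq_lintegral_dens (hZ : Measurable Z)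
    (hlaw : P.map Z = (volume.restrict (unitCube d)).withDensity fun z => ENNReal.ofReal (dens z))
    {A : Set (EuclideanSpace ℝ (Fin d))} (hA : MeasurableSet A) :
    P (Z ⁻¹' A) = ∫⁻ z in A ∩ unitCube d, ENNReal.ofReal (dens z) := by
  rw [← Measure.map_apply hZ hA, hlaw, withDensity_apply _ hA, Measure.restrict_restrict hA]

theorem measureReal_preimage_ge [IsFiniteMeasure P] (hZ : Measurable Z)
    (hlaw : P.map Z = (volume.restrict (unitCube d)).withDensity fun z => ENNReal.ofReal (dens z))
    (hc₁ : 0 < c₁) (hbd : ∀ z ∈ unitCube d, c₁ ≤ dens z)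
    {A : Set (EuclideanSpace ℝ (Fin d))} (hA : MeasurableSet A) (hAc : A ⊆ unitCube d) :
    c₁ * volume.real A ≤ P.real (Z ⁻¹' A) := by
  have h : ENNReal.ofReal c₁ * volume A ≤ P (Z ⁻¹' A) := by
    rw [measure_preimage_eq_lintegral_dens hZ hlaw hA, Set.inter_eq_left.mpr hAc,
      ← setLIntegral_const]
    exact setLIntegral_mono' hA fun z hz => ENNReal.ofReal_le_ofReal (hbd z (hAc hz))
  have := ENNReal.toReal_mono (measure_ne_top P _) h
  rwa [ENNReal.toReal_mul, ENNReal.toReal_ofReal hc₁.le] at this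

theorem measureReal_preimage_le (hZ : Measurable Z)
    (hlaw : P.map Z = (volume.restrict (unitCube d)).withDensity fun z => ENNReal.ofReal (dens z))
    (hc₂ : 0 ≤ c₂) (hbd : ∀ z ∈ unitCube d, dens z ≤ c₂)
    {U : Set (EuclideanSpace ℝ (Fin d))} (hU : MeasurableSet U) (hUfin : volume U ≠ ∞) :
    P.real (Z ⁻¹' U) ≤ c₂ * volume.real U := by
  have h : P (Z ⁻¹' U) ≤ ENNReal.ofReal c₂ * volume U := by
    rw [measure_preimage_eq_lintegral_dens hZ hlaw hU]
    calc ∫⁻ z in U ∩ unitCube d, ENNReal.ofReal (dens z)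
        ≤ ∫⁻ _ in U ∩ unitCube d, ENNReal.ofReal c₂ :=
          setLIntegral_mono' (hU.inter measurableSet_unitCube) fun z hz =>
            ENNReal.ofReal_le_ofReal (hbd z hz.2)
      _ ≤ ENNReal.ofReal c₂ * volume U := by
          rw [setLIntegral_const]
          gcongr
          exact Set.inter_subset_left
  have := ENNReal.toReal_mono (ENNReal.mul_ne_top ENNReal.ofReal_ne_top hUfin) h
  rwa [ENNReal.toReal_mul, ENNReal.toReal_ofReal hc₂] at this

end Geometry

/-! ### Asymptotics of the rates. -/

section Rates

theorem tendsto_natCast_rpow_atTop {p : ℝ} (hp : 0 < p) :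
    Tendsto (fun n : ℕ => (n : ℝ) ^ p) atTop atTop :=
  (tendsto_rpow_atTop hp).comp tendsto_natCast_atTop_atTop

theorem tendsto_natCast_rpow_neg {p : ℝ} (hp : 0 < p) :
    Tendsto (fun n : ℕ => (n : ℝ) ^ (-p)) atTop (𝓝 0) :=
  (tendsto_rpow_neg_atTop hp).comp tendsto_natCast_atTop_atTop

/-- The bound on the size of the tree space beats the union bound. -/
theorem tendsto_card_mul_exp {s ν α κ : ℝ} (hν : 0 < ν) (hκ : 0 < κ) {N : ℕ → ℝ}
    (hN0 : ∀ n, 0 ≤ N n)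
    (hN : N =O[atTop] fun n : ℕ => (1 / (n : ℝ)) *
      Real.exp ((1 / 2) * (n : ℝ) ^ (s - ν) - (n : ℝ) ^ α)) :
    Tendsto (fun n : ℕ => N n * Real.exp (-(κ * (n : ℝ) ^ (s + ν)))) atTop (𝓝 0) := by
  obtain ⟨C, hC⟩ := hN.bound
  -- The prefactor `1/n` alone yields the limit; the combined exponential only has to stay at most
  -- one, which holds once `κ n^(2ν) ≥ 1/2`.
  have hlim : Tendsto (fun n : ℕ => |C| * (1 / (n : ℝ))) atTop (𝓝 0) := by
    simpa using tendsto_one_div_atTop_nhds_zero_nat.const_mul |C|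
  refine squeeze_zero' (.of_forall fun n => mul_nonneg (hN0 n) (Real.exp_pos _).le) ?_ hlim
  filter_upwards [hC, eventually_gt_atTop 0,
    (tendsto_natCast_rpow_atTop (p := 2 * ν) (by linarith)).eventually_ge_atTop (1 / (2 * κ))]
    with n h1 h2 h3
  have hn : (0 : ℝ) < n := by exact_mod_cast h2
  rw [Real.norm_of_nonneg (hN0 n), Real.norm_of_nonneg (by positivity)] at h1
  have hexp : (1 / 2) * (n : ℝ) ^ (s - ν) - (n : ℝ) ^ α - κ * (n : ℝ) ^ (s + ν) ≤ 0 := by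
    have hsplit : (n : ℝ) ^ (s + ν) = (n : ℝ) ^ (s - ν) * (n : ℝ) ^ (2 * ν) := by
      rw [← Real.rpow_add hn]
      congr 1
      ring
    have hpos : 0 < (n : ℝ) ^ (s - ν) := by positivity
    have hα : 0 < (n : ℝ) ^ α := by positivity
    have h4 : 1 / 2 ≤ κ * (n : ℝ) ^ (2 * ν) := by
      rw [div_le_iff₀ (by positivity)] at h3
      linarith
    rw [hsplit]
    nlinarith
  calc N n * Real.exp (-(κ * (n : ℝ) ^ (s + ν)))
      ≤ |C| * ((1 / (n : ℝ)) * Real.exp ((1 / 2) * (n : ℝ) ^ (s - ν) - (n : ℝ) ^ α)) *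
          Real.exp (-(κ * (n : ℝ) ^ (s + ν))) := by
        gcongr
        exact h1.trans (by gcongr; exact le_abs_self C)
    _ = |C| * (1 / (n : ℝ)) *
          Real.exp ((1 / 2) * (n : ℝ) ^ (s - ν) - (n : ℝ) ^ α - κ * (n : ℝ) ^ (s + ν)) := by
        rw [sub_eq_add_neg _ (κ * _), Real.exp_add]
        ring
    _ ≤ |C| * (1 / (n : ℝ)) * 1 := by
        gcongr
        exact Real.exp_le_one_iff.mpr hexp
    _ = _ := mul_one _

/-- The subsamples are so large that they miss a leaf with small probability. -/
theorem eventually_exp_subsample_le {s ν κ : ℝ} (hν : 0 < ν) (hκ : 0 < κ) {m : ℕ → ℕ}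
    (hm : ∀ᶠ n : ℕ in atTop, (n : ℝ) ^ (1 - s) * Real.log n ≤ m n) :
    ∀ᶠ n : ℕ in atTop, Real.exp (-((m n : ℝ) * (κ * (n : ℝ) ^ (s + ν)) / n)) ≤ 1 / 2 := by
  have hlim : Tendsto (fun n : ℕ => κ * ((n : ℝ) ^ ν * Real.log n)) atTop atTop :=
    ((tendsto_natCast_rpow_atTop hν).atTop_mul_atTop₀
      (Real.tendsto_log_atTop.comp tendsto_natCast_atTop_atTop)).const_mul_atTop hκ
  filter_upwards [hm, eventually_gt_atTop 0, hlim.eventually_ge_atTop 1] with n h1 h2 h3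
  have hn : (0 : ℝ) < n := by exact_mod_cast h2
  -- The exponent is at least `κ n^ν log n`, which diverges.
  have hge : 1 ≤ (m n : ℝ) * (κ * (n : ℝ) ^ (s + ν)) / n := by
    refine h3.trans ?_
    rw [le_div_iff₀ hn]
    have hsplit : (n : ℝ) ^ ν * n = (n : ℝ) ^ (1 - s) * (n : ℝ) ^ (s + ν) := by
      rw [← Real.rpow_add hn, ← Real.rpow_add_one hn.ne']
      congr 1
      ring
    calc κ * ((n : ℝ) ^ ν * Real.log n) * n = κ * Real.log n * ((n : ℝ) ^ ν * n) := by ring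
      _ = ((n : ℝ) ^ (1 - s) * Real.log n) * (κ * (n : ℝ) ^ (s + ν)) := by
          rw [hsplit]
          ring
      _ ≤ _ := by gcongr
  calc Real.exp (-((m n : ℝ) * (κ * (n : ℝ) ^ (s + ν)) / n)) ≤ Real.exp (-1) := by gcongr
    _ ≤ 1 / 2 := by
        rw [Real.exp_neg, inv_le_comm₀ (Real.exp_pos 1) (by norm_num)]
        have := Real.exp_one_gt_d9
        norm_num at this ⊢
        linarith

end Rates

/-! ### Negligibility of the entries of `r_n` in probability. -/

section Negligibility

variable {d : ℕ} {Ω : Type*} [MeasurableSpace Ω] {P : Measure Ω} [IsProbabilityMeasure P]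
  {X : ℕ → Ω → EuclideanSpace ℝ (Fin d)} {x : EuclideanSpace ℝ (Fin d)}

/-- With high probability all leaves at `x` hold many sample points. -/
theorem measureReal_exists_leaf_le (hX : ∀ i, Measurable (X i)) (hindep : iIndepFun X P)
    (Q : Finset (TreeStructure d)) (hx : x ∈ unitCube d) {p : ℝ}
    (hp : ∀ q ∈ Q, ∀ A ∈ q.leaves, x ∈ A → ∀ i, p ≤ P.real (X i ⁻¹' A)) (n : ℕ) :
    P.real {ω | ∃ q ∈ Q, ∃ A ∈ q.leaves, x ∈ A ∧
      sampleCount A (fun i : Fin n => X i ω) ≤ n * p / 2} ≤ Q.card * Real.exp (-(n * p / 8)) := by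
  -- Each tree has exactly one leaf containing `x`, so the union bound runs over trees only.
  choose leaf hleaf hxleaf using fun q : TreeStructure d => q.exists_leaf hx
  have hsub : {ω | ∃ q ∈ Q, ∃ A ∈ q.leaves, x ∈ A ∧
      sampleCount A (fun i : Fin n => X i ω) ≤ n * p / 2} ⊆
      ⋃ q ∈ Q, {ω | sampleCount (leaf q) (fun i : Fin n => X i ω) ≤ n * p / 2} := by
    rintro ω ⟨q, hq, A, hA, hxA, hω⟩
    have hAq : A = leaf q := by
      by_contra hne
      exact Set.disjoint_left.mp (q.disjoint A hA (leaf q) (hleaf q) hne) hxA (hxleaf q)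
    exact Set.mem_biUnion hq (show _ ≤ _ from hAq ▸ hω)
  calc _ ≤ P.real (⋃ q ∈ Q, {ω | sampleCount (leaf q) (fun i : Fin n => X i ω) ≤ n * p / 2}) :=
        measureReal_mono hsub (measure_ne_top P _)
    _ ≤ ∑ q ∈ Q, P.real {ω | sampleCount (leaf q) (fun i : Fin n => X i ω) ≤ n * p / 2} :=
        measureReal_biUnion_finset_le _ _
    _ ≤ ∑ _q ∈ Q, Real.exp (-(n * p / 8)) := Finset.sum_le_sum fun q hq =>
        measure_sampleCount_le hX hindep (q.rectangle _ (hleaf q)).measurableSet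
          (hp q hq _ (hleaf q) (hxleaf q)) n
    _ = _ := by rw [Finset.sum_const, nsmul_eq_mul]

/-- The entries of `r_n` are, with probability tending to one, uniformly negligible compared to its
Euclidean norm. -/
theorem tendsto_measure_rVec_not_negligible
    (hX : ∀ i, Measurable (X i)) (hindep : iIndepFun X P)
    {dens : EuclideanSpace ℝ (Fin d) → ℝ} {c₁ c₂ : ℝ} (hc₁ : 0 < c₁)
    (hbd : ∀ z ∈ unitCube d, c₁ ≤ dens z ∧ dens z ≤ c₂)
    (hlaw : ∀ i, P.map (X i) =
      (volume.restrict (unitCube d)).withDensity fun z => ENNReal.ofReal (dens z))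
    {lam : ℝ} (hlam0 : 0 < lam) (hlam1 : lam < 1) (S : TreeScheme d) {s : ℝ}
    (hs : ((d : ℝ) + 2) * s = 1)
    (hsub : ∀ᶠ n : ℕ in atTop, (n : ℝ) ^ (1 - s) * Real.log n ≤ S.m n)
    {C : ℝ} (hC : 0 ≤ C) {ε₁ : ℝ} (hd : 0 < d) (hε₁ : 0 < ε₁)
    (hdiam : ∀ᶠ n : ℕ in atTop, ∀ q ∈ S.Q n, ∀ A ∈ q.leaves,
      Metric.diam A ≤ C * (n : ℝ) ^ (-s - ε₁))
    {ν : ℝ} (hν : 0 < ν) {c : ℝ} (hc : 0 < c)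
    (hvol : ∀ᶠ n : ℕ in atTop, ∀ q ∈ S.Q n, ∀ A ∈ q.leaves,
      c * (n : ℝ) ^ (-(1 - s) + ν) ≤ volume.real A)
    {α : ℝ} (hcard : (fun n : ℕ => ((S.Q n).card : ℝ)) =O[atTop] fun n : ℕ =>
      (1 / (n : ℝ)) * Real.exp ((1 / 2) * (n : ℝ) ^ (s - ν) - (n : ℝ) ^ α))
    (hx : x ∈ unitCube d) {η : ℝ} (hη : 0 < η) :
    Tendsto (fun n : ℕ => P.real {ω | ¬ (0 < ∑ j, S.rVec lam n (fun i => X i ω) x j ^ 2 ∧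
      ∀ i, S.rVec lam n (fun i => X i ω) x i ^ 2 ≤
        η * ∑ j, S.rVec lam n (fun i => X i ω) x j ^ 2)}) atTop (𝓝 0) := by
  have hc₂ : 0 ≤ c₂ := hc₁.le.trans ((hbd x hx).1.trans (hbd x hx).2)
  set V := volume.real (Metric.ball (0 : EuclideanSpace ℝ (Fin d)) 1) with hV
  set K := (lam / (1 - lam)) ^ 2 * (8 * ((1 / lam) ^ 2 + 1)) with hK
  have hK0 : 0 ≤ K := by positivity
  have hbound1 := tendsto_card_mul_exp (κ := c₁ * c / 8) hν (by positivity)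
    (fun n => Nat.cast_nonneg _) hcard
  have hbound2 : Tendsto (fun n : ℕ => c₂ * (C ^ d * V) * (n : ℝ) ^ (-(d * ε₁))) atTop (𝓝 0) := by
    simpa using (tendsto_natCast_rpow_neg (p := d * ε₁) (by positivity)).const_mul _
  have hratio : ∀ᶠ n : ℕ in atTop, K * (1 / (c₁ * c / 2) ^ 2 * (n : ℝ) ^ (-(2 * ν))) < η := by
    have : Tendsto (fun n : ℕ => K * (1 / (c₁ * c / 2) ^ 2 * (n : ℝ) ^ (-(2 * ν)))) atTop (𝓝 0) := by
      have h := ((tendsto_natCast_rpow_neg (p := 2 * ν) (by positivity)).const_mul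
        (1 / (c₁ * c / 2) ^ 2)).const_mul K
      rwa [mul_zero, mul_zero] at h
    exact this.eventually_lt_const hη
  have hexp := eventually_exp_subsample_le (κ := c₁ * c / 2) hν (by positivity) hsub
  refine squeeze_zero' (.of_forall fun _ => measureReal_nonneg) ?_
    (by simpa using hbound1.add hbound2)
  filter_upwards [eventually_gt_atTop 0, hdiam, hvol, hratio, hexp] with n hn0 hnd hnv hnr hne
  have hn : (0 : ℝ) < n := by exact_mod_cast hn0
  set R := C * (n : ℝ) ^ (-s - ε₁) with hR
  have hR0 : 0 ≤ R := by positivity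
  set U := Metric.closedBall x R with hU
  set p := c₁ * (c * (n : ℝ) ^ (-(1 - s) + ν)) with hp
  have hnp : n * p = c₁ * c * (n : ℝ) ^ (s + ν) := by
    have : (n : ℝ) ^ (s + ν) = (n : ℝ) ^ (-(1 - s) + ν) * n := by
      rw [← Real.rpow_add_one hn.ne']
      congr 1
      ring
    rw [this, hp]
    ring
  have hpA : ∀ q ∈ S.Q n, ∀ A ∈ q.leaves, x ∈ A → ∀ i, p ≤ P.real (X i ⁻¹' A) :=
    fun q hq A hA _ i => (mul_le_mul_of_nonneg_left (hnv q hq A hA) hc₁.le).trans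
      (measureReal_preimage_ge (hX i) (hlaw i) hc₁ (fun z hz => (hbd z hz).1)
        (q.rectangle A hA).measurableSet (q.leaf_subset_unitCube hA))
  have hpU : ∀ i, P.real (X i ⁻¹' U) ≤ c₂ * (R ^ d * V) := by
    intro i
    have h := measureReal_preimage_le (hX i) (hlaw i) hc₂ (fun z hz => (hbd z hz).2)
      (U := U) measurableSet_closedBall measure_closedBall_lt_top.ne
    have hvolU : volume.real U = R ^ d * V := by
      rw [hU, measureReal_def, Measure.addHaar_closedBall _ _ hR0, ENNReal.toReal_mul,
        ENNReal.toReal_ofReal (by positivity), finrank_euclideanSpace_fin]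
      rfl
    rwa [hvolU] at h
  -- The threshold `n^(2s)` exceeds the expected number of points in the ball, of order at most
  -- `n^(1 - d(s+ε₁)) = n^(2s - dε₁)`, by a factor of order at least `n^(dε₁)`.
  have hM : 0 < (n : ℝ) ^ (2 * s) := by positivity
  have hb1 := measureReal_exists_leaf_le hX hindep (S.Q n) hx hpA n
  have hb2 := measure_lt_sampleCount_le (P := P) hX (U := U) measurableSet_closedBall hpU n hM
  have hsubset : {ω | ¬ (0 < ∑ j, S.rVec lam n (fun i => X i ω) x j ^ 2 ∧
      ∀ i, S.rVec lam n (fun i => X i ω) x i ^ 2 ≤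
        η * ∑ j, S.rVec lam n (fun i => X i ω) x j ^ 2)} ⊆
      {ω | ∃ q ∈ S.Q n, ∃ A ∈ q.leaves, x ∈ A ∧
        sampleCount A (fun i : Fin n => X i ω) ≤ n * p / 2} ∪
      {ω | (n : ℝ) ^ (2 * s) < sampleCount U (fun i : Fin n => X i ω)} := by
    intro ω hω
    by_contra hgood
    refine hω ?_
    rw [Set.mem_union, not_or] at hgood
    obtain ⟨hg1, hg2⟩ := hgood
    have hg1' : ∀ q ∈ S.Q n, ∀ A ∈ q.leaves, x ∈ A →
        c₁ * c / 2 * (n : ℝ) ^ (s + ν) ≤ sampleCount A (fun i : Fin n => X i ω) := by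
      intro q hq A hA hxA
      by_contra hlt
      push Not at hlt
      refine hg1 ⟨q, hq, A, hA, hxA, ?_⟩
      rw [hnp]
      linarith
    have hg2' : sampleCount U (fun i : Fin n => X i ω) ≤ (n : ℝ) ^ (2 * s) := not_lt.mp hg2
    obtain ⟨h1, h2⟩ := S.sq_rVec_le hlam0 hlam1 (fun i : Fin n => X i ω) hx (U := U)
      (by positivity) hM
      (fun q hq A hA hxA => q.leaf_subset_closedBall hA hxA (hnd q hq A hA)) hg1' hg2' hne
    refine ⟨h1, fun i => (h2 i).trans (mul_le_mul_of_nonneg_right ?_ h1.le)⟩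
    -- This is `M₀ / N₀²`: the powers of `n^s` cancel and only `n^(-2ν)` remains.
    have heq : (n : ℝ) ^ (2 * s) / (c₁ * c / 2 * (n : ℝ) ^ (s + ν)) ^ 2 =
        1 / (c₁ * c / 2) ^ 2 * (n : ℝ) ^ (-(2 * ν)) := by
      have h3 : (n : ℝ) ^ (2 * s) = (n : ℝ) ^ (-(2 * ν)) * ((n : ℝ) ^ (s + ν)) ^ 2 := by
        rw [← Real.rpow_natCast, ← Real.rpow_mul hn.le, ← Real.rpow_add hn]
        congr 1
        push_cast
        ring
      have h4 : (n : ℝ) ^ (s + ν) ≠ 0 := by positivity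
      rw [h3]
      field_simp
    rw [heq]
    exact hnr.le
  refine (measureReal_mono hsubset).trans ((measureReal_union_le _ _).trans (add_le_add ?_ ?_))
  · refine hb1.trans (le_of_eq ?_)
    rw [hnp]
    congr 3
    ring
  · refine hb2.trans (le_of_eq ?_)
    -- The exponents match because `(d+2) s = 1`, that is `1 - d s = 2 s`.
    have h1 : (n : ℝ) ^ (-(d * ε₁)) * (n : ℝ) ^ (2 * s) = n * ((n : ℝ) ^ (-s - ε₁)) ^ d := by
      rw [← Real.rpow_natCast, ← Real.rpow_mul hn.le, ← Real.rpow_add hn]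
      nth_rewrite 2 [← Real.rpow_one (n : ℝ)]
      rw [← Real.rpow_add hn]
      congr 1
      linarith
    rw [div_eq_iff hM.ne', mul_assoc _ _ ((n : ℝ) ^ (2 * s)), h1, hR, mul_pow]
    ring

end Negligibility

/-! ### Assembly of the limit theorem. -/

theorem mainTheorem8
    {d : ℕ} (hd : 0 < d) {Ω : Type*} [MeasurableSpace Ω] (P : Measure Ω) [IsProbabilityMeasure P]
    -- the covariates are i.i.d. on the cube, with a density bounded above and below
    (X : ℕ → Ω → EuclideanSpace ℝ (Fin d)) (hXmeas : ∀ i, Measurable (X i))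
    (hXindep : iIndepFun X P)
    (dens : EuclideanSpace ℝ (Fin d) → ℝ) (hdens : Measurable dens)
    (c₁ c₂ : ℝ) (hc₁ : 0 < c₁) (hbd : ∀ z ∈ unitCube d, c₁ ≤ dens z ∧ dens z ≤ c₂)
    (hXlaw : ∀ i, P.map (X i) =
      (volume.restrict (unitCube d)).withDensity fun z => ENNReal.ofReal (dens z))
    -- the regression function is bounded and Lipschitz
    (f : EuclideanSpace ℝ (Fin d) → ℝ) (Mf : ℝ) (hfbd : ∀ z ∈ unitCube d, |f z| ≤ Mf)
    (L : ℝ≥0) (hfLip : LipschitzOnWith L f (unitCube d))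
    -- the errors are i.i.d. sub-Gaussian, and independent of the covariates
    (e : ℕ → Ω → ℝ) (hemeas : ∀ i, Measurable (e i)) (heindep : iIndepFun e P)
    (heident : ∀ i, IdentDistrib (e i) (e 0) P P)
    (hesub : ∃ c : ℝ≥0, HasSubgaussianMGF (e 0) c P)
    (hemean : ∫ ω, e 0 ω ∂P = 0)
    (σ2 : ℝ≥0) (hevar : ∫ ω, e 0 ω ^ 2 ∂P = σ2)
    (hefourth : Integrable (fun ω => e 0 ω ^ 4) P)
    (hXe : IndepFun (fun ω i => X i ω) (fun ω i => e i ω) P)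
    -- the learning rate and the non-adaptive tree building scheme
    (lam : ℝ) (hlam0 : 0 < lam) (hlam1 : lam < 1) (S : TreeScheme d)
    (hsub : ∀ᶠ n : ℕ in atTop,
      (n : ℝ) ^ (((d : ℝ) + 1) / ((d : ℝ) + 2)) * Real.log n ≤ S.m n)
    -- upper bound on the leaf diameters
    (dn : ℕ → ℝ) (hdn : ∀ n, 0 < dn n)
    (hdiam : ∃ C : ℝ, ∀ᶠ n in atTop, ∀ q ∈ S.Q n, ∀ A ∈ q.leaves, Metric.diam A ≤ C * dn n)
    (ε₁ : ℝ) (hε₁ : 0 < ε₁)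
    (hdnrate : dn =O[atTop] fun n : ℕ => (n : ℝ) ^ (-(1 / ((d : ℝ) + 2)) - ε₁))
    -- lower bound on the leaf volumes
    (ν : ℝ) (hν : 0 < ν)
    (hvol : ∃ c : ℝ, 0 < c ∧ ∀ᶠ n : ℕ in atTop, ∀ q ∈ S.Q n, ∀ A ∈ q.leaves,
      c * (n : ℝ) ^ (-(((d : ℝ) + 1) / ((d : ℝ) + 2)) + ν) ≤ volume.real A)
    -- bound on the cardinality of the tree space
    (α : ℝ) (hα : 0 < α)
    (hcard : (fun n : ℕ => ((S.Q n).card : ℝ)) =O[atTop] fun n : ℕ =>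
      (1 / (n : ℝ)) *
        Real.exp ((1 / 2) * (n : ℝ) ^ (1 / ((d : ℝ) + 2) - ν) - (n : ℝ) ^ α))
    -- the point of prediction
    (x : EuclideanSpace ℝ (Fin d)) (hx : x ∈ unitCube d) :
    ∃ fhat : (n : ℕ) → (Fin n → EuclideanSpace ℝ (Fin d)) → (Fin n → ℝ) → ℝ,
      (∀ n xs ys, IsBoulevardLimit S lam n xs ys x (fhat n xs ys)) ∧
      TendstoInDistribution
        (fun (n : ℕ) (ω : Ω) =>
          (fhat n (fun i => X i ω) (fun i => f (X i ω) + e i ω) -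
              S.rVec lam n (fun i => X i ω) x ⬝ᵥ fun i => f (X i ω)) /
            ‖WithLp.toLp 2 (S.rVec lam n (fun i => X i ω) x)‖)
        atTop (id : ℝ → ℝ) (fun _ => P) (gaussianReal 0 σ2) := by
  have hd2 : (0 : ℝ) < (d : ℝ) + 2 := by positivity
  set s : ℝ := 1 / ((d : ℝ) + 2) with hs
  have hs1 : ((d : ℝ) + 1) / ((d : ℝ) + 2) = 1 - s := by
    rw [hs]
    field_simp
    ring
  have hs2 : ((d : ℝ) + 2) * s = 1 := by
    rw [hs]
    field_simp
  rw [hs1] at hsub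
  simp_rw [hs1] at hvol
  obtain ⟨c, hc, hvol⟩ := hvol
  obtain ⟨C, hC, hdiam⟩ : ∃ C : ℝ, 0 ≤ C ∧ ∀ᶠ n : ℕ in atTop, ∀ q ∈ S.Q n, ∀ A ∈ q.leaves,
      Metric.diam A ≤ C * (n : ℝ) ^ (-s - ε₁) := by
    obtain ⟨C, hC⟩ := hdiam
    obtain ⟨C', hC'⟩ := hdnrate.bound
    refine ⟨|C| * |C'|, by positivity, ?_⟩
    filter_upwards [hC, hC'] with n h1 h2 q hq A hA
    rw [Real.norm_of_nonneg (hdn n).le, Real.norm_of_nonneg (by positivity)] at h2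
    calc Metric.diam A ≤ C * dn n := h1 q hq A hA
      _ ≤ |C| * (|C'| * (n : ℝ) ^ (-s - ε₁)) := by
          refine mul_le_mul (le_abs_self C) (h2.trans ?_) (hdn n).le (abs_nonneg C)
          gcongr
          exact le_abs_self C'
      _ = _ := by ring
  refine ⟨fun n xs ys => S.rVec lam n xs x ⬝ᵥ ys,
    fun n xs ys => isBoulevardLimit_rVec S hlam0 hlam1 xs ys x, ?_⟩
  have hnorm : ∀ (n : ℕ) (xs : Fin n → EuclideanSpace ℝ (Fin d)),
      ‖WithLp.toLp 2 (S.rVec lam n xs x)‖ = Real.sqrt (∑ j, S.rVec lam n xs x j ^ 2) := by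
    intro n xs
    rw [EuclideanSpace.norm_eq]
    simp
  have hrm : ∀ n j, Measurable fun xs : Fin n → EuclideanSpace ℝ (Fin d) =>
      S.rVec lam n xs x j := fun n j => S.measurable_rVec lam x j
  obtain ⟨cs, hcs⟩ := hesub
  have hclt := tendstoInDistribution_weighted_sum (P := P)
    (X := fun n ω (i : Fin n) => X i ω) (fun n => measurable_pi_iff.mpr fun i => hXmeas i)
    hemeas heindep heident (hcs.memLp 2) hemean hevar
    (fun n => hXe.comp (φ := fun (g : ℕ → EuclideanSpace ℝ (Fin d)) (i : Fin n) => g i)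
      (ψ := fun (g : ℕ → ℝ) (i : Fin n) => g i)
      (measurable_pi_iff.mpr fun i => measurable_pi_apply _)
      (measurable_pi_iff.mpr fun i => measurable_pi_apply _))
    (a := fun n xs i => S.rVec lam n xs x i / Real.sqrt (∑ j, S.rVec lam n xs x j ^ 2))
    (fun n i => (hrm n i).div
      (Finset.measurable_sum _ fun j _ => (hrm n j).pow_const 2).sqrt) ?_
  -- The signal `r_nᵀ f(X)` cancels exactly, so no bias term has to be estimated.
  · convert hclt using 3 with n ω
    rw [hnorm, ← dotProduct_sub]
    simp only [dotProduct, Pi.sub_apply, add_sub_cancel_left, Finset.sum_div]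
    refine Finset.sum_congr rfl fun i _ => ?_
    ring
  -- Negligibility is used with `η = δ²`, since it is stated for squares. Positivity of `‖r_n‖²` on
  -- the good event makes the weights exactly normalized there.
  · intro δ hδ
    have hreal := tendsto_measure_rVec_not_negligible hXmeas hXindep hc₁ hbd hXlaw hlam0 hlam1 S
      hs2 hsub hC hd hε₁ hdiam hν hc hvol hcard hx (η := δ ^ 2) (by positivity)
    have hreal' := ENNReal.tendsto_ofReal hreal
    simp only [measureReal_def, ENNReal.ofReal_toReal (measure_ne_top P _), ENNReal.ofReal_zero]
      at hreal'
    refine tendsto_of_tendsto_of_tendsto_of_le_of_le tendsto_const_nhds hreal'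
      (fun _ => zero_le) fun n => measure_mono fun ω hω hgood => hω ?_
    obtain ⟨hpos, hle⟩ := hgood
    constructor
    · simp_rw [div_pow, Real.sq_sqrt hpos.le]
      rw [← Finset.sum_div, div_self hpos.ne']
    · intro i
      refine abs_le_of_sq_le_sq ?_ hδ.le
      rw [div_pow, Real.sq_sqrt hpos.le, div_le_iff₀ hpos]
      exact hle i
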